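/- Let $T=(N,E)$ be a directed tree with root $r\in N$, where $N$ is at most countable: $E\subseteq N\times N$ and every node is reached from $r$ by exactly one directed walk (the trivial one for $r$ itself). Let $F=(F_n)_{n\in N}$ be univariate distribution functions and let $B=(B_e)_{e\in E}$, $C=(C_e)_{e\in E}$ be families of bivariate copulas. A random sequence $X=(X_n)_{n\in N}$ follows the Markov tree distribution $\mathcal M(F,T,B)$ if * $X_n$ has distribution function $F_n$ for every $n\in N$; * $P(X_i\le s,\,X_j\le t)=B_{(i,j)}(F_i(s),F_j(t))$ for all $(i,j)\in E$ and $s,t\in\mathbb R$; * for all finite disjoint $A,A'\subset N$ and every $i\in N$ that lies strictly inside the undirected path between $a$ and $a'$ for all $a\in A$, $a'\in A'$, the vectors $(X_n)_{n\in A}$ and $(X_n)_{n\in A'}$ are conditionally independent given $X_i$. A bivariate copula is SI if a random vector $(U,V)$ with this distribution function has $V$ stochastically increasing in $U$, i.e. the conditional law of $V$ given $U=u$ is increasing in $u$ in the usual stochastic order, outside a null set of the law of $U$; it is CI if moreover $U$ is stochastically increasing in $V$. We write $B_e\le_{lo}C_e$ if $B_e(u,v)\le C_e(u,v)$ for all $u,v\in[0,1]$.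 A function $f:\mathbb R^m\to\mathbb R$ is supermodular if $f(x)+f(y)\le f(x\wedge y)+f(x\vee y)$ for all $x,y$, with componentwise minimum and maximum. For random vectors, $V\le_{sm}W$ means that $\mathbb E f(V)\le\mathbb E f(W)$ for every weight $b(x)=1+\sum_{i=1}^m\varphi_i(x_i)$ with measurable $\varphi_i:\mathbb R\to[0,\infty)$, $\mathbb E\,b(V)<\infty$ and $\mathbb E\,b(W)<\infty$, and every measurable supermodular $f$ with $\sup_x|f(x)|/b(x)<\infty$. (All bounded $f$ are covered, and all $f$ of growth $O(1+\|x\|^p)$ if the components have finite $p$-th moments.) For random sequences, $V\le_{sm}W$ means $(V_{n_1},\dots,V_{n_m})\le_{sm}(W_{n_1},\dots,W_{n_m})$ for all $m$ and all $n_1,\dots,n_m\in N$. A random sequence $V$ is positive supermodular dependent (PSMD) if $V^\perp\le_{sm}V$, where $V^\perp$ has independent components with the same marginal laws as $V$. Let $X\sim\mathcal M(F,T,B)$ and $Y\sim\mathcal M(F,T,C)$. Assume that $B_e$ is SI and $C_e$ is CI for every $e\in E$. 1. If $B_e\le_{lo}C_e$ for all $e\in E$, then $X\le_{sm}Y$.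 2. If $B_e\ge_{lo}C_e$ for all $e\in E$, then $X\ge_{sm}Y$. Moreover, $X$ and $Y$ are PSMD. -/

import Mathlib

open MeasureTheory ProbabilityTheory Set
open scoped unitInterval

noncomputable section

/-! ### Directed trees -/

/-- `l` is the list of nodes visited by a directed walk from `i` to `j` along the edges `E`. -/
def IsDirectedWalk {N : Type*} (E : N → N → Prop) (i j : N) (l : List N) : Prop :=
  l.IsChain E ∧ l.head? = some i ∧ l.getLast? = some j

/-- `(N, E)` is a directed tree (arborescence) with root `r`: every node is reached from the root
by exactly one directed walk (for the root itself, the trivial one). Uniqueness among walks rules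
out loops, edges into the root and edges back to an ancestor; all walks from the root are then
paths. -/
def IsDirectedTree {N : Type*} (E : N → N → Prop) (r : N) : Prop :=
  ∀ i, ∃! l, IsDirectedWalk E r i l

/-- The node `i` separates `A` and `B`: on every undirected path between a node of `A` and a node
of `B`, `i` is a node other than the two endpoints. -/
def Separates {N : Type*} (E : N → N → Prop) (i : N) (A B : Finset N) : Prop :=
  ∀ a ∈ A, ∀ b ∈ B, ∀ p : (SimpleGraph.fromRel E).Walk a b, p.IsPath →
    i ∈ p.support ∧ i ≠ a ∧ i ≠ b

/-! ### Stochastic monotonicity -/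

/-- The stochastic order of distributions on the real line. -/
def StLE (μ ν : Measure ℝ) : Prop :=
  ∀ f : ℝ → ℝ, Monotone f → Integrable f μ → Integrable f ν → ∫ x, f x ∂μ ≤ ∫ x, f x ∂ν

/-- For `(U, V)` with law `γ`, the variable `V` is stochastically increasing in `U`: the
conditional law of `V` given `U = u` is increasing in `u` in the stochastic order, outside a null
set of the law of `U`. -/
def StochIncreasing (γ : Measure (ℝ × ℝ)) [IsFiniteMeasure γ] : Prop :=
  ∃ S : Set ℝ, γ.fst S = 0 ∧
    ∀ u ∉ S, ∀ u' ∉ S, u ≤ u' → StLE (γ.condKernel u) (γ.condKernel u')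

/-! ### Bivariate copulas -/

/-- The law `γ` of a bivariate random vector has distribution function `C` on the unit square. -/
def HasDF (γ : Measure (ℝ × ℝ)) (C : I → I → ℝ) : Prop :=
  ∀ u v : I, γ.real (Iic (u : ℝ) ×ˢ Iic (v : ℝ)) = C u v

/-- A bivariate copula: the restriction to the unit square of a bivariate distribution function
whose univariate marginals are uniform on `[0, 1]`. -/
structure Copula where
  toFun : I → I → ℝ
  exists_law : ∃ γ : Measure (ℝ × ℝ), IsProbabilityMeasure γ ∧
    γ.fst = volume.restrict (Icc 0 1) ∧ γ.snd = volume.restrict (Icc 0 1) ∧ HasDF γ toFun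

/-- The copula `C` is SI: some `(U, V)` with distribution function `C` has `V` stochastically
increasing in `U`. -/
def Copula.IsSI (C : Copula) : Prop :=
  ∃ (γ : Measure (ℝ × ℝ)) (_ : IsProbabilityMeasure γ), HasDF γ C.toFun ∧ StochIncreasing γ

/-- The copula `C` is CI: some `(U, V)` with distribution function `C` has `V` stochastically
increasing in `U` and `U` stochastically increasing in `V`. -/
def Copula.IsCI (C : Copula) : Prop :=
  ∃ (γ : Measure (ℝ × ℝ)) (_ : IsProbabilityMeasure γ), HasDF γ C.toFun ∧
    StochIncreasing γ ∧ StochIncreasing (γ.map Prod.swap)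

/-- The lower orthant order of copulas. -/
def Copula.LoLE (C D : Copula) : Prop :=
  ∀ u v : I, C.toFun u v ≤ D.toFun u v

/-! ### Markov tree distributions -/

/-- Markov tree dependence: whenever `i` separates the disjoint finite sets `A` and `B`, the
subvectors indexed by `A` and by `B` are conditionally independent given coordinate `i`. -/
def HasMarkovTreeDependence {N : Type*} [Countable N] (E : N → N → Prop)
    (μ : Measure (N → ℝ)) [IsFiniteMeasure μ] : Prop :=
  ∀ (A B : Finset N) (i : N), Disjoint A B → Separates E i A B →
    CondIndepFun (MeasurableSpace.comap (fun x : N → ℝ => x i) inferInstance)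
      (measurable_pi_apply i).comap_le
      (fun (x : N → ℝ) (a : A) => x a) (fun (x : N → ℝ) (b : B) => x b) μ

/-- `μ` realizes the bivariate tree specification `(F, (N, E), B)`: `F n` is the distribution
function of coordinate `n`, and `B i j` is a copula of coordinates `(i, j)` for each edge. -/
def Realizes {N : Type*} (F : N → ℝ → I) (E : N → N → Prop) (B : ∀ i j, E i j → Copula)
    (μ : Measure (N → ℝ)) : Prop :=
  (∀ n t, μ.real {x | x n ≤ t} = F n t) ∧
  ∀ i j (h : E i j) s t, μ.real {x | x i ≤ s ∧ x j ≤ t} = (B i j h).toFun (F i s) (F j t)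

/-- The random sequence `X` follows the Markov tree distribution `M(F, (N, E), B)`. -/
def FollowsMarkovTree {N Ω : Type*} [Countable N] [MeasurableSpace Ω]
    (F : N → ℝ → I) (E : N → N → Prop) (B : ∀ i j, E i j → Copula)
    (X : Ω → N → ℝ) (P : Measure Ω) : Prop :=
  ∃ (μ : Measure (N → ℝ)) (_ : IsProbabilityMeasure μ),
    HasLaw X μ P ∧ Realizes F E B μ ∧ HasMarkovTreeDependence E μ

/-! ### The supermodular order -/

/-- Supermodularity with respect to componentwise minimum and maximum. -/
def Supermodular {ι : Type*} (f : (ι → ℝ) → ℝ) : Prop :=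
  ∀ x y, f x + f y ≤ f (x ⊓ y) + f (x ⊔ y)

/-- The weight function `b(x) = 1 + ∑ i, φ i (x i)`. For `φ i t = |t| ^ p` it is equivalent, up to
constant factors, to `max 1 (‖x‖ ^ p)`. -/
def weight {ι : Type*} [Fintype ι] (φ : ι → ℝ → ℝ) (x : ι → ℝ) : ℝ :=
  1 + ∑ i, φ i (x i)

/-- The supermodular order of laws of random vectors: for every weight `b` for which both laws are
`b`-integrable, the integrals of all measurable `b`-bounded supermodular functions are ordered.
Such functions are integrable with respect to both laws. -/
def SupermodularLE {ι : Type*} [Fintype ι] (μ ν : Measure (ι → ℝ)) : Prop :=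
  ∀ φ : ι → ℝ → ℝ, (∀ i, Measurable (φ i)) → (∀ i t, 0 ≤ φ i t) →
    Integrable (weight φ) μ → Integrable (weight φ) ν →
    ∀ f : (ι → ℝ) → ℝ, Measurable f → Supermodular f → (∃ c, ∀ x, |f x| ≤ c * weight φ x) →
      ∫ x, f x ∂μ ≤ ∫ x, f x ∂ν

/-- The supermodular order of laws of random sequences: all vectors of finitely many coordinates
are ordered. For finite `N` an enumeration of `N` gives the comparison of the whole vectors. -/
def ProcessSupermodularLE {N : Type*} (μ ν : Measure (N → ℝ)) : Prop :=
  ∀ (m : ℕ) (k : Fin m → N),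
    SupermodularLE (μ.map fun x i => x (k i)) (ν.map fun x i => x (k i))

/-- Positive supermodular dependence: the law of independent coordinates with the same marginals
is smaller in the supermodular order. -/
def PSMD {N : Type*} (μ : Measure (N → ℝ)) : Prop :=
  ProcessSupermodularLE (Measure.infinitePi fun n => μ.map fun x => x n) μ

end

/-! ### Measures on the line and on the plane -/

/-! The comparison grows a finite subtree leaf by leaf. Let `μ`, `ν` be the two laws and attach a
leaf `j` to a node `p` of a rooted subtree `A`. Integrating out coordinate `j` turns `g` into
`resample K p j g`, a function on `A`, where `K` is the law of coordinate `j` given coordinate `p`.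
Between `∫ g ∂μ` and `∫ g ∂ν` stands a hybrid: the coordinates in `A` follow `ν`, but `j` is drawn
from the kernel of `μ`.

From `μ` to the hybrid: SI makes the kernel of `μ` increasing, so resampling preserves
supermodularity (`Supermodular.resample`) and the induction hypothesis on `A` applies. From the
hybrid to `ν`: only the law of the edge changes. Averaging `g` over the coordinates in `A` given
that coordinate `p` is `s`, with coordinate `j` set to `t`, gives a function of `(s, t)`. It has
increasing differences if the subvector on `A` is stochastically increasing in coordinate `p`
(`IsMonotoneConditional.increasingDifferences`), and for such functions the orthant order suffices
(`OrthantLE.integral_le`). Since `p` is an arbitrary node, monotonicity must propagate along edges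
both ways; this is the role of CI (`IsMarkovAlong.exists_isMonotoneConditional`). Reversing the
order of the edge laws reverses every inequality, so `IsMarkovAlong.integral_le` gives both
assertions. For PSMD the second law is the product of the marginals, which lies below every SI edge
law (`SetwiseIncreasing.orthantLE`).

Conditional kernels are monotone only almost everywhere, and the copulas live on another scale. SI
is therefore encoded by the product inequality `SetwiseIncreasing`, moved by quantile transforms
(`SetwiseIncreasing.of_copula`), and converted into everywhere monotone kernels that are correct off
a set of small measure (`SetwiseIncreasing.nearlyMonotone`). Unbounded test functions are handled by
`supermodularLE_of_bounded`, which truncates arguments rather than values. -/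

theorem IsUpperSet.measure_le_of_Ioi {α β : Measure ℝ} [IsFiniteMeasure α] [IsFiniteMeasure β]
    (huniv : α univ = β univ) (h : ∀ t, α (Ioi t) ≤ β (Ioi t)) {U : Set ℝ} (hU : IsUpperSet U) :
    α U ≤ β U := by
  have hIci (a : ℝ) : α (Ici a) ≤ β (Ici a) := by
    have h1 : ∀ γ : Measure ℝ, IsFiniteMeasure γ →
        Filter.Tendsto (fun n : ℕ => γ (Ioi (a - 1 / ((n : ℝ) + 1)))) Filter.atTop
          (nhds (γ (Ici a))) := by
      intro γ _
      have heq : Ici a = ⋂ n : ℕ, Ioi (a - 1 / ((n : ℝ) + 1)) := by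
        ext x
        simp only [mem_Ici, mem_iInter, mem_Ioi]
        constructor
        · intro hx n
          have : (0 : ℝ) < 1 / ((n : ℝ) + 1) := by positivity
          linarith
        · intro hx
          by_contra hlt
          obtain ⟨n, hn⟩ := exists_nat_one_div_lt (sub_pos.2 (not_le.1 hlt))
          linarith [hx n]
      rw [heq]
      refine tendsto_measure_iInter_atTop (fun n => measurableSet_Ioi.nullMeasurableSet) ?_
        ⟨0, measure_ne_top _ _⟩
      intro m n hmn
      refine Ioi_subset_Ioi ?_
      have : 1 / ((n : ℝ) + 1) ≤ 1 / ((m : ℝ) + 1) := by gcongr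
      linarith
    exact le_of_tendsto_of_tendsto' (h1 α inferInstance) (h1 β inferInstance) fun n => h _
  -- An upper set of reals is empty, the whole line, or a half-line starting at its infimum.
  rcases U.eq_empty_or_nonempty with rfl | hne
  · simp
  by_cases hb : BddBelow U
  · have hsub : Ioi (sInf U) ⊆ U := by
      intro x hx
      obtain ⟨y, hy, hyx⟩ := exists_lt_of_csInf_lt hne hx
      exact hU hyx.le hy
    have hsup : U ⊆ Ici (sInf U) := fun x hx => csInf_le hb hx
    by_cases ha : sInf U ∈ U
    · have : U = Ici (sInf U) := subset_antisymm hsup fun x hx => hU hx ha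
      rw [this]; exact hIci _
    · have : U = Ioi (sInf U) := by
        refine subset_antisymm (fun x hx => ?_) hsub
        refine mem_Ioi.2 (lt_of_le_of_ne (mem_Ici.1 (hsup hx)) ?_)
        rintro rfl; exact ha hx
      rw [this]; exact h _
  · have : U = univ := by
      refine eq_univ_of_forall fun x => ?_
      rw [not_bddBelow_iff] at hb
      obtain ⟨y, hy, hyx⟩ := hb x
      exact hU hyx.le hy
    rw [this, huniv]

theorem Measurable.integrable_of_abs_le {α : Type*} [MeasurableSpace α] {μ : Measure α}
    [IsFiniteMeasure μ] {f : α → ℝ} (hf : Measurable f) {c : ℝ} (hc : ∀ x, |f x| ≤ c) :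
    Integrable f μ :=
  Integrable.of_bound hf.aestronglyMeasurable c (Filter.Eventually.of_forall hc)

/-- Comparison of integrals of bounded monotone functions from comparison of upper tails. -/
theorem Monotone.integral_le_of_Ioi {α β : Measure ℝ} [IsFiniteMeasure α] [IsFiniteMeasure β]
    (huniv : α univ = β univ) (h : ∀ t, α (Ioi t) ≤ β (Ioi t)) {g : ℝ → ℝ} (hg : Monotone g)
    {c : ℝ} (hc : ∀ x, |g x| ≤ c) : ∫ x, g x ∂α ≤ ∫ x, g x ∂β := by
  have key : ∫ x, (g x + c) ∂α ≤ ∫ x, (g x + c) ∂β := by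
    have h0 : ∀ x, 0 ≤ g x + c := fun x => by linarith [(abs_le.1 (hc x)).1]
    have hm : Measurable fun x => g x + c := hg.measurable.add_const c
    have h_int : ∀ γ : Measure ℝ, IsFiniteMeasure γ → Integrable (fun x => g x + c) γ :=
      fun γ _ => (hg.measurable.integrable_of_abs_le hc).add (integrable_const c)
    rw [integral_eq_lintegral_of_nonneg_ae (Filter.Eventually.of_forall h0) hm.aestronglyMeasurable,
      integral_eq_lintegral_of_nonneg_ae (Filter.Eventually.of_forall h0) hm.aestronglyMeasurable]
    refine ENNReal.toReal_mono (h_int β inferInstance).lintegral_lt_top.ne ?_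
    -- Layer cake formula: the superlevel sets of a monotone function are upper sets.
    rw [lintegral_eq_lintegral_meas_lt _ (Filter.Eventually.of_forall h0) hm.aemeasurable,
      lintegral_eq_lintegral_meas_lt _ (Filter.Eventually.of_forall h0) hm.aemeasurable]
    refine lintegral_mono fun t => IsUpperSet.measure_le_of_Ioi huniv h ?_
    intro x y hxy hx
    simp only [mem_ofPred_eq] at hx ⊢
    linarith [hg hxy]
  have e : ∀ γ : Measure ℝ, IsFiniteMeasure γ →
      ∫ x, (g x + c) ∂γ = ∫ x, g x ∂γ + γ.real univ * c := fun γ _ => by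
    rw [integral_add (hg.measurable.integrable_of_abs_le hc) (integrable_const c)]; simp
  rw [e α inferInstance, e β inferInstance, measureReal_def, measureReal_def, huniv] at key
  linarith

/-- Every nonempty compact set of reals is a monotone retract of the line. -/
theorem IsCompact.exists_monotone_retraction {K : Set ℝ} (hK : IsCompact K) (hne : K.Nonempty) :
    ∃ π : ℝ → ℝ, Monotone π ∧ (∀ t, π t ∈ K) ∧ ∀ t ∈ K, π t = t := by
  have hmem (t : ℝ) : sInf K ∈ K ∩ Iic (max t (sInf K)) :=
    ⟨hK.sInf_mem hne, by simp⟩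
  have hcomp (t : ℝ) : IsCompact (K ∩ Iic (max t (sInf K))) := hK.inter_right isClosed_Iic
  -- The largest point of `K` not exceeding `t`; the maximum with `sInf K` serves the points to the
  -- left of `K`.
  refine ⟨fun t => sSup (K ∩ Iic (max t (sInf K))), ?_, ?_, ?_⟩
  · intro s t hst
    refine csSup_le_csSup (hcomp t).bddAbove ⟨_, hmem s⟩ ?_
    exact inter_subset_inter_right _ (Iic_subset_Iic.2 (max_le_max_right _ hst))
  · intro t
    exact ((hcomp t).sSup_mem ⟨_, hmem t⟩).1
  · intro t ht
    have hle : sInf K ≤ t := csInf_le hK.bddBelow ht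
    simp only [max_eq_left hle]
    refine le_antisymm (csSup_le ⟨t, ht, le_refl t⟩ fun x hx => hx.2) ?_
    exact le_csSup (hK.inter_right isClosed_Iic).bddAbove ⟨ht, le_refl t⟩

/-! ### The lower orthant order and functions with increasing differences -/

/-- Increasing differences of a function of two real variables. -/
def IncreasingDifferences (h : ℝ × ℝ → ℝ) : Prop :=
  ∀ s s' t t', s ≤ s' → t ≤ t' → h (s, t') + h (s', t) ≤ h (s, t) + h (s', t')

/-- The lower orthant order of laws on the plane with equal marginals. -/
structure OrthantLE (γ δ : Measure (ℝ × ℝ)) : Prop where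
  fst_eq : γ.fst = δ.fst
  snd_eq : γ.snd = δ.snd
  le : ∀ s t, γ (Iic s ×ˢ Iic t) ≤ δ (Iic s ×ˢ Iic t)

section Orthant

variable {γ δ : Measure (ℝ × ℝ)}

theorem OrthantLE.integral_fst_eq (H : OrthantLE γ δ) {g : ℝ → ℝ} (hg : Measurable g) :
    ∫ z, g z.1 ∂γ = ∫ z, g z.1 ∂δ := by
  have e : ∀ γ : Measure (ℝ × ℝ), ∫ z, g z.1 ∂γ = ∫ s, g s ∂γ.fst := fun γ => by
    rw [Measure.fst, integral_map measurable_fst.aemeasurable hg.aestronglyMeasurable]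
  rw [e, e, H.fst_eq]

theorem OrthantLE.integral_snd_eq (H : OrthantLE γ δ) {g : ℝ → ℝ} (hg : Measurable g) :
    ∫ z, g z.2 ∂γ = ∫ z, g z.2 ∂δ := by
  have e : ∀ γ : Measure (ℝ × ℝ), ∫ z, g z.2 ∂γ = ∫ s, g s ∂γ.snd := fun γ => by
    rw [Measure.snd, integral_map measurable_snd.aemeasurable hg.aestronglyMeasurable]
  rw [e, e, H.snd_eq]

variable [IsProbabilityMeasure γ] [IsProbabilityMeasure δ]

/-- Restricting to first coordinate at most `s` leaves measures of equal mass on the second axis.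
Passing to complements turns the orthant inequalities into reversed tail inequalities. -/
theorem OrthantLE.prod_Iic_upper_le (H : OrthantLE γ δ) (s : ℝ) {U : Set ℝ} (hU : IsUpperSet U) :
    δ (Iic s ×ˢ U) ≤ γ (Iic s ×ˢ U) := by
  have hUm : MeasurableSet U := hU.ordConnected.measurableSet
  have hm : ∀ (γ : Measure (ℝ × ℝ)) {V : Set ℝ} (_ : MeasurableSet V),
      (γ.restrict (Iic s ×ˢ univ)).snd V = γ (Iic s ×ˢ V) := fun γ V hV => by
    rw [Measure.snd_apply hV, Measure.restrict_apply (measurable_snd hV)]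
    congr 1; ext z; simp [and_comm]
  have huniv : (γ.restrict (Iic s ×ˢ univ)).snd univ = (δ.restrict (Iic s ×ˢ univ)).snd univ := by
    rw [hm _ .univ, hm _ .univ]
    have e : ∀ γ : Measure (ℝ × ℝ), γ (Iic s ×ˢ univ) = γ.fst (Iic s) := fun γ => by
      rw [Measure.fst_apply measurableSet_Iic]; congr 1; ext; simp
    rw [e, e, H.fst_eq]
  rw [← hm _ hUm, ← hm _ hUm]
  refine IsUpperSet.measure_le_of_Ioi huniv.symm (fun t => ?_) hU
  rw [← compl_Iic, measure_compl measurableSet_Iic (measure_ne_top _ _),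
    measure_compl measurableSet_Iic (measure_ne_top _ _), huniv, hm _ measurableSet_Iic,
    hm _ measurableSet_Iic]
  exact tsub_le_tsub_left (H.le s t) _

theorem OrthantLE.integral_upper_le (H : OrthantLE γ δ) {U : Set ℝ} (hU : IsUpperSet U)
    {g : ℝ → ℝ} (hg : Monotone g) {c : ℝ} (hc : ∀ x, |g x| ≤ c) :
    ∫ z, U.indicator (fun _ => g z.1) z.2 ∂γ ≤ ∫ z, U.indicator (fun _ => g z.1) z.2 ∂δ := by
  have hUm : MeasurableSet U := hU.ordConnected.measurableSet
  have hm : ∀ (γ : Measure (ℝ × ℝ)) {V : Set ℝ} (_ : MeasurableSet V),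
      (γ.restrict (univ ×ˢ U)).fst V = γ (V ×ˢ U) := fun γ V hV => by
    rw [Measure.fst_apply hV, Measure.restrict_apply (measurable_fst hV)]
    congr 1; ext z; simp
  have e : ∀ γ : Measure (ℝ × ℝ), ∫ z, U.indicator (fun _ => g z.1) z.2 ∂γ =
      ∫ s, g s ∂(γ.restrict (univ ×ˢ U)).fst := fun γ => by
    rw [Measure.fst, integral_map measurable_fst.aemeasurable hg.measurable.aestronglyMeasurable,
      ← integral_indicator (MeasurableSet.univ.prod hUm)]
    refine integral_congr_ae (Filter.Eventually.of_forall fun z => ?_)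
    by_cases hz : z.2 ∈ U <;> simp [indicator, hz]
  have huniv : (γ.restrict (univ ×ˢ U)).fst univ = (δ.restrict (univ ×ˢ U)).fst univ := by
    rw [hm _ .univ, hm _ .univ]
    have e : ∀ γ : Measure (ℝ × ℝ), γ (univ ×ˢ U) = γ.snd U := fun γ => by
      rw [Measure.snd_apply hUm]; congr 1; ext; simp
    rw [e, e, H.snd_eq]
  rw [e, e]
  refine hg.integral_le_of_Ioi huniv (fun t => ?_) hc
  rw [← compl_Iic, measure_compl measurableSet_Iic (measure_ne_top _ _),
    measure_compl measurableSet_Iic (measure_ne_top _ _), huniv, hm _ measurableSet_Iic,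
    hm _ measurableSet_Iic]
  exact tsub_le_tsub_left (H.prod_Iic_upper_le t hU) _

/-- Telescoping over the values of `ψ`: lowering the top value `a` to the next value `b` removes `h
(s, a) - h (s, b)` on an upper set of `t`. This difference is monotone in `s` by increasing
differences, so `OrthantLE.integral_upper_le` applies. -/
theorem OrthantLE.integral_le_of_finite_range (H : OrthantLE γ δ) {h : ℝ × ℝ → ℝ}
    (hh : Measurable h) {c : ℝ} (hc : ∀ z, |h z| ≤ c) (hinc : IncreasingDifferences h)
    (G : Finset ℝ) :
    ∀ ψ : ℝ → ℝ, Monotone ψ → (∀ t, ψ t ∈ G) →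
      ∫ z, h (z.1, ψ z.2) ∂γ ≤ ∫ z, h (z.1, ψ z.2) ∂δ := by
  induction G using Finset.induction_on_max with
  | empty => intro ψ _ hG; simpa using hG 0
  | insert a G ha ih =>
    intro ψ hψ hG
    rcases G.eq_empty_or_nonempty with rfl | hne
    · have : ∀ t, ψ t = a := fun t => by simpa using hG t
      simp only [this]
      exact (H.integral_fst_eq (g := fun s => h (s, a)) (by fun_prop)).le
    set b := G.max' hne with hb
    have hba : b < a := ha b (G.max'_mem hne)
    have hψ' : Monotone fun t => min (ψ t) b := fun s t hst => min_le_min_right _ (hψ hst)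
    have hG' : ∀ t, min (ψ t) b ∈ G := fun t => by
      rcases Finset.mem_insert.1 (hG t) with h1 | h1
      · rw [h1, min_eq_right hba.le]; exact G.max'_mem hne
      · rwa [min_eq_left (G.le_max' _ h1)]
    have hU : IsUpperSet {t | b < ψ t} := fun s t hst hs => lt_of_lt_of_le hs (hψ hst)
    have hdm : Monotone fun s => h (s, a) - h (s, b) := fun s s' hs => by
      have := hinc s s' b a hs hba.le
      simp only; linarith
    have hdc : ∀ s, |h (s, a) - h (s, b)| ≤ c + c := fun s =>
      (abs_sub _ _).trans (add_le_add (hc _) (hc _))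
    have hsplit : ∀ z : ℝ × ℝ, h (z.1, ψ z.2) = h (z.1, min (ψ z.2) b) +
        {t | b < ψ t}.indicator (fun _ => h (z.1, a) - h (z.1, b)) z.2 := fun z => by
      rcases Finset.mem_insert.1 (hG z.2) with h1 | h1
      · have : z.2 ∈ {t | b < ψ t} := by simp only [mem_ofPred_eq]; rw [h1]; exact hba
        rw [indicator_of_mem this, h1, min_eq_right hba.le]; ring
      · have h2 := G.le_max' _ h1
        have : z.2 ∉ {t | b < ψ t} := by simpa using h2
        rw [indicator_of_notMem this, min_eq_left h2, add_zero]
    have hm1 : Measurable fun z : ℝ × ℝ => h (z.1, min (ψ z.2) b) :=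
      hh.comp (measurable_fst.prodMk (hψ'.measurable.comp measurable_snd))
    have hm2 : Measurable fun z : ℝ × ℝ =>
        {t | b < ψ t}.indicator (fun _ => h (z.1, a) - h (z.1, b)) z.2 := by
      have : (fun z : ℝ × ℝ => {t | b < ψ t}.indicator (fun _ => h (z.1, a) - h (z.1, b)) z.2) =
          (Prod.snd ⁻¹' {t | b < ψ t}).indicator fun z : ℝ × ℝ => h (z.1, a) - h (z.1, b) := by
        ext z; simp [indicator]
      rw [this]
      exact Measurable.indicator (by fun_prop) (measurable_snd hU.ordConnected.measurableSet)
    have hi1 : ∀ γ : Measure (ℝ × ℝ), IsProbabilityMeasure γ →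
        Integrable (fun z : ℝ × ℝ => h (z.1, min (ψ z.2) b)) γ :=
      fun γ _ => hm1.integrable_of_abs_le fun z => hc _
    have hi2 : ∀ γ : Measure (ℝ × ℝ), IsProbabilityMeasure γ → Integrable (fun z : ℝ × ℝ =>
        {t | b < ψ t}.indicator (fun _ => h (z.1, a) - h (z.1, b)) z.2) γ := by
      refine fun γ _ => hm2.integrable_of_abs_le (c := c + c) fun z => ?_
      by_cases hz : z.2 ∈ {t | b < ψ t}
      · rw [indicator_of_mem hz]; exact hdc _
      · rw [indicator_of_notMem hz, abs_zero]; exact (abs_nonneg _).trans (hdc 0)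
    simp only [hsplit]
    rw [integral_add (hi1 γ inferInstance) (hi2 γ inferInstance),
      integral_add (hi1 δ inferInstance) (hi2 δ inferInstance)]
    exact add_le_add (ih _ hψ' hG') (H.integral_upper_le hU hdm hdc)

/-- `ψ` picks one representative from each level set of `⌊w t / ε⌋`. It is near the identity only as
seen through `w`, so `w` may jump. -/
theorem Monotone.exists_finite_range_approx {w : ℝ → ℝ} (hw : Monotone w) {c : ℝ}
    (hc : ∀ t, |w t| ≤ c) {ε : ℝ} (hε : 0 < ε) :
    ∃ ψ : ℝ → ℝ, Monotone ψ ∧ (range ψ).Finite ∧ ∀ t, |w (ψ t) - w t| ≤ ε := by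
  classical
  set a : ℝ → ℤ := fun t => ⌊w t / ε⌋ with ha
  have hsel : ∀ t, ∃ u, a u = a t := fun t => ⟨t, rfl⟩
  set rep : ℤ → ℝ := fun l => if h : ∃ u, a u = l then h.choose else 0 with hrep
  have hrepa : ∀ t, a (rep (a t)) = a t := fun t => by
    simp only [hrep, dif_pos (hsel t)]; exact (hsel t).choose_spec
  have ham : Monotone a := fun s t hst => Int.floor_le_floor (by have := hw hst; gcongr)
  refine ⟨fun t => rep (a t), ?_, ?_, ?_⟩
  · intro s t hst
    rcases (ham hst).eq_or_lt with h | h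
    · simp only [h, le_refl]
    · by_contra hlt
      have := ham (not_le.1 hlt).le
      simp only [hrepa] at this
      omega
  · refine ((Set.finite_Icc ⌊(-c) / ε⌋ ⌊c / ε⌋).image rep).subset ?_
    rintro _ ⟨t, rfl⟩
    refine ⟨a t, ⟨Int.floor_le_floor ?_, Int.floor_le_floor ?_⟩, rfl⟩
    · have := (abs_le.1 (hc t)).1; gcongr
    · have := (abs_le.1 (hc t)).2; gcongr
  · intro t
    have h := Int.abs_sub_lt_one_of_floor_eq_floor (hrepa t)
    rw [← sub_div, abs_div, abs_of_pos hε, div_lt_one hε] at h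
    exact h.le

/-- As `h` need not be continuous, the steps must be adapted to it. With the first coordinate
clamped to `[-R, R]` and `h (-R, t)` subtracted, all increments in `t` are dominated, uniformly in
`s`, by those of the monotone function `h (R, t) - h (-R, t)`; a step approximation adapted to it is
uniformly good. The subtracted term sees only the common marginal. -/
theorem OrthantLE.integral_clamp_le (H : OrthantLE γ δ) {h : ℝ × ℝ → ℝ}
    (hh : Measurable h) {c : ℝ} (hc : ∀ z, |h z| ≤ c) (hinc : IncreasingDifferences h)
    {R : ℝ} (hR : 0 ≤ R) :
    ∫ z, h (max (-R) (min z.1 R), z.2) ∂γ ≤ ∫ z, h (max (-R) (min z.1 R), z.2) ∂δ := by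
  set p : ℝ → ℝ := fun s => max (-R) (min s R) with hp
  have hpm : Monotone p := fun s t hst => max_le_max_left _ (min_le_min_right _ hst)
  have hpl : ∀ s, -R ≤ p s := fun s => le_max_left _ _
  have hpu : ∀ s, p s ≤ R := fun s => max_le (by linarith) (min_le_right _ _)
  set k : ℝ × ℝ → ℝ := fun z => h (p z.1, z.2) - h (-R, z.2) with hk
  have hkm : Measurable k := by
    have := hpm.measurable
    fun_prop
  have hkc : ∀ z, |k z| ≤ c + c := fun z => (abs_sub _ _).trans (add_le_add (hc _) (hc _))
  have hkinc : IncreasingDifferences k := fun s s' t t' hs ht => by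
    have := hinc (p s) (p s') t t' (hpm hs) ht
    simp only [hk]; linarith
  have hwm : Monotone fun t => h (R, t) - h (-R, t) := fun t t' ht => by
    have := hinc (-R) R t t' (by linarith) ht
    simp only; linarith
  have hctrl' : ∀ s t t', t ≤ t' → |k (s, t') - k (s, t)| ≤
      |(h (R, t') - h (-R, t')) - (h (R, t) - h (-R, t))| := fun s t t' ht => by
    have h1 := hinc (-R) (p s) t t' (hpl s) ht
    have h2 := hinc (p s) R t t' (hpu s) ht
    have e1 : 0 ≤ k (s, t') - k (s, t) := by simp only [hk]; linarith
    rw [abs_of_nonneg e1]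
    refine le_trans ?_ (le_abs_self _)
    simp only [hk]; linarith
  have hctrl : ∀ s t t', |k (s, t') - k (s, t)| ≤
      |(h (R, t') - h (-R, t')) - (h (R, t) - h (-R, t))| := fun s t t' => by
    rcases le_total t t' with ht | ht
    · exact hctrl' s t t' ht
    · rw [abs_sub_comm, abs_sub_comm (h (R, t') - h (-R, t'))]; exact hctrl' s t' t ht
  have hkint : ∀ γ : Measure (ℝ × ℝ), IsProbabilityMeasure γ → Integrable k γ :=
    fun γ _ => hkm.integrable_of_abs_le hkc
  have main : ∫ z, k z ∂γ ≤ ∫ z, k z ∂δ := by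
    refine le_of_forall_pos_le_add fun ε hε => ?_
    obtain ⟨ψ, hψ, hfin, happ⟩ := hwm.exists_finite_range_approx (c := c + c)
      (fun t => (abs_sub _ _).trans (add_le_add (hc _) (hc _))) (half_pos hε)
    have hstep := H.integral_le_of_finite_range hkm hkc hkinc hfin.toFinset ψ hψ (fun t => by simp)
    have happ' : ∀ z : ℝ × ℝ, |k (z.1, ψ z.2) - k z| ≤ ε / 2 := fun z =>
      (hctrl z.1 z.2 (ψ z.2)).trans (happ z.2)
    have hψint : ∀ γ : Measure (ℝ × ℝ), IsProbabilityMeasure γ →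
        Integrable (fun z : ℝ × ℝ => k (z.1, ψ z.2)) γ := fun γ _ =>
      Measurable.integrable_of_abs_le
        (hkm.comp (measurable_fst.prodMk (hψ.measurable.comp measurable_snd))) fun z => hkc _
    have hγ : ∫ z, k z ∂γ ≤ ∫ z, (k (z.1, ψ z.2) + ε / 2) ∂γ :=
      integral_mono (hkint γ inferInstance) ((hψint γ inferInstance).add (integrable_const _))
        fun z => by linarith [(abs_le.1 (happ' z)).1]
    have hδ : ∫ z, k (z.1, ψ z.2) ∂δ ≤ ∫ z, (k z + ε / 2) ∂δ :=
      integral_mono (hψint δ inferInstance) ((hkint δ inferInstance).add (integrable_const _))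
        fun z => by linarith [(abs_le.1 (happ' z)).2]
    rw [integral_add (hψint γ inferInstance) (integrable_const _)] at hγ
    rw [integral_add (hkint δ inferInstance) (integrable_const _)] at hδ
    simp only [integral_const, probReal_univ, one_smul] at hγ hδ
    linarith
  have hsnd := H.integral_snd_eq (g := fun t => h (-R, t)) (by fun_prop)
  have hsi : ∀ γ : Measure (ℝ × ℝ), IsProbabilityMeasure γ →
      Integrable (fun z : ℝ × ℝ => h (-R, z.2)) γ := fun γ _ =>
    Measurable.integrable_of_abs_le (by fun_prop) fun z => hc _
  have e : ∀ z : ℝ × ℝ, h (max (-R) (min z.1 R), z.2) = k z + h (-R, z.2) := fun z => by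
    simp [hk, hp]
  simp only [e]
  rw [integral_add (hkint γ inferInstance) (hsi γ inferInstance),
    integral_add (hkint δ inferInstance) (hsi δ inferInstance), hsnd]
  linarith

/-- The lower orthant order implies the ordering of the integrals of all bounded measurable
functions with increasing differences. -/
theorem OrthantLE.integral_le (H : OrthantLE γ δ) {h : ℝ × ℝ → ℝ}
    (hh : Measurable h) {c : ℝ} (hc : ∀ z, |h z| ≤ c) (hinc : IncreasingDifferences h) :
    ∫ z, h z ∂γ ≤ ∫ z, h z ∂δ := by
  have hlim : ∀ γ : Measure (ℝ × ℝ), IsProbabilityMeasure γ →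
      Filter.Tendsto (fun n : ℕ => ∫ z, h (max (-(n : ℝ)) (min z.1 n), z.2) ∂γ) Filter.atTop
        (nhds (∫ z, h z ∂γ)) := fun γ _ => by
    refine tendsto_integral_of_dominated_convergence (fun _ => c)
      (fun n => (Measurable.aestronglyMeasurable (by fun_prop))) (integrable_const c)
      (fun n => Filter.Eventually.of_forall fun z => hc _) (Filter.Eventually.of_forall fun z => ?_)
    refine tendsto_const_nhds.congr' ?_
    obtain ⟨m, hm⟩ := exists_nat_ge |z.1|
    filter_upwards [Filter.eventually_ge_atTop m] with n hn
    have hn' : |z.1| ≤ n := hm.trans (by exact_mod_cast hn)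
    rw [min_eq_left (abs_le.1 hn').2, max_eq_right (abs_le.1 hn').1]
  exact le_of_tendsto_of_tendsto' (hlim γ inferInstance) (hlim δ inferInstance) fun n =>
    H.integral_clamp_le hh hc hinc n.cast_nonneg

end Orthant

/-! ### Stochastic monotonicity in terms of conditional probabilities of sets -/

/-- Elementary form of stochastic monotonicity: for `A` to the left of `A'`, the conditional
probability of an upper tail of the second coordinate given `A` is at most the one given `A'`. -/
def SetwiseIncreasing (γ : Measure (ℝ × ℝ)) : Prop :=
  ∀ ⦃A A' : Set ℝ⦄, MeasurableSet A → MeasurableSet A' → (∀ a ∈ A, ∀ a' ∈ A', a < a') →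
    ∀ t, γ (A ×ˢ Ioi t) * γ.fst A' ≤ γ (A' ×ˢ Ioi t) * γ.fst A

/-- The infimum `c` of the conditional tail probabilities over `A' \ S` bounds their average over
`A` from above and their average over `A'` from below. -/
theorem StochIncreasing.setwiseIncreasing {γ : Measure (ℝ × ℝ)} [IsProbabilityMeasure γ]
    (h : StochIncreasing γ) : SetwiseIncreasing γ := by
  obtain ⟨S, hS, hmono⟩ := h
  have hK : ∀ u ∉ S, ∀ u' ∉ S, u ≤ u' → ∀ t,
      γ.condKernel u (Ioi t) ≤ γ.condKernel u' (Ioi t) := by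
    intro u hu u' hu' huu t
    have hm : Monotone ((Ioi t).indicator fun _ => (1 : ℝ)) := by
      intro x y hxy
      by_cases hx : x ∈ Ioi t
      · have hy : y ∈ Ioi t := lt_of_lt_of_le (mem_Ioi.1 hx) hxy
        rw [indicator_of_mem hx, indicator_of_mem hy]
      · rw [indicator_of_notMem hx]
        exact indicator_nonneg (fun _ _ => zero_le_one) _
    have hi : ∀ α : Measure ℝ, IsProbabilityMeasure α →
        Integrable ((Ioi t).indicator fun _ => (1 : ℝ)) α := fun α _ =>
      (integrable_const _).indicator measurableSet_Ioi
    have := hmono u hu u' hu' huu _ hm (hi _ inferInstance) (hi _ inferInstance)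
    change ∫ x, (Ioi t).indicator 1 x ∂_ ≤ ∫ x, (Ioi t).indicator 1 x ∂_ at this
    rw [integral_indicator_one measurableSet_Ioi, integral_indicator_one measurableSet_Ioi] at this
    exact (ENNReal.toReal_le_toReal (measure_ne_top _ _) (measure_ne_top _ _)).1 this
  intro A A' hA hA' hlt t
  rw [← Measure.setLIntegral_condKernel_eq_measure_prod hA measurableSet_Ioi,
    ← Measure.setLIntegral_condKernel_eq_measure_prod hA' measurableSet_Ioi]
  have hae : ∀ᵐ u ∂γ.fst, u ∉ S := measure_eq_zero_iff_ae_notMem.1 hS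
  set c := ⨅ u' ∈ A' \ S, γ.condKernel u' (Ioi t) with hc
  have h1 : ∫⁻ u in A, γ.condKernel u (Ioi t) ∂γ.fst ≤ c * γ.fst A := by
    rw [← setLIntegral_const]
    refine setLIntegral_mono_ae' hA ?_
    filter_upwards [hae] with u hu huA
    exact le_iInf₂ fun u' hu' => hK u hu u' hu'.2 (hlt u huA u' hu'.1).le t
  have h2 : c * γ.fst A' ≤ ∫⁻ u in A', γ.condKernel u (Ioi t) ∂γ.fst := by
    rw [← setLIntegral_const]
    refine setLIntegral_mono_ae' hA' ?_
    filter_upwards [hae] with u hu huA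
    exact iInf₂_le u ⟨huA, hu⟩
  calc _ ≤ c * γ.fst A * γ.fst A' := by gcongr
    _ = c * γ.fst A' * γ.fst A := by ring
    _ ≤ _ := by gcongr

theorem SetwiseIncreasing.prod (α β : Measure ℝ) [IsProbabilityMeasure α]
    [IsProbabilityMeasure β] : SetwiseIncreasing (α.prod β) := by
  intro A A' _ _ _ t
  rw [Measure.fst_prod, Measure.prod_prod, Measure.prod_prod]
  exact le_of_eq (by ring)

/-- Stochastic monotonicity implies positive quadrant dependence. -/
theorem SetwiseIncreasing.orthantLE {γ : Measure (ℝ × ℝ)} [IsProbabilityMeasure γ]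
    (h : SetwiseIncreasing γ) : OrthantLE (γ.fst.prod γ.snd) γ where
  fst_eq := Measure.fst_prod
  snd_eq := Measure.snd_prod
  le s t := by
    -- The tail given `Iic s` is at most the tail given `Ioi s`, hence at most the unconditional
    -- tail; complements in `t` give the quadrant inequality.
    have hs := h (measurableSet_Iic (a := s)) (measurableSet_Ioi (a := s))
      (fun a ha a' ha' => lt_of_le_of_lt (mem_Iic.1 ha) (mem_Ioi.1 ha')) t
    have hr : ∀ {α : Type} [MeasurableSpace α] (μ : Measure α) [IsProbabilityMeasure μ] (A : Set α),
      μ A = ENNReal.ofReal (μ.real A) := fun μ _ A => (ofReal_measureReal (measure_ne_top _ _)).symm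
    have e1 : γ.real (Iic s ×ˢ Ioi t) = γ.fst.real (Iic s) - γ.real (Iic s ×ˢ Iic t) := by
      have : γ.fst.real (Iic s) = γ.real (Iic s ×ˢ Iic t ∪ Iic s ×ˢ Ioi t) := by
        rw [measureReal_def, Measure.fst_apply measurableSet_Iic, ← prod_union, Iic_union_Ioi,
          measureReal_def]
        congr 2; ext; simp
      rw [this, measureReal_union _ (measurableSet_Iic.prod measurableSet_Ioi)]
      · ring
      · rw [Set.disjoint_left]; rintro z ⟨_, hz⟩ ⟨_, hz'⟩; exact not_lt.2 (mem_Iic.1 hz) hz'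
    have e2 : γ.real (Ioi s ×ˢ Ioi t) = 1 - γ.snd.real (Iic t) - γ.real (Iic s ×ˢ Ioi t) := by
      have : 1 - γ.snd.real (Iic t) = γ.real (Iic s ×ˢ Ioi t ∪ Ioi s ×ˢ Ioi t) := by
        rw [← probReal_compl_eq_one_sub measurableSet_Iic, compl_Iic, measureReal_def,
          Measure.snd_apply measurableSet_Ioi, ← union_prod, Iic_union_Ioi, measureReal_def]
        congr 2; ext; simp
      rw [this, measureReal_union _ (measurableSet_Ioi.prod measurableSet_Ioi)]
      · ring
      · rw [Set.disjoint_left]; rintro z ⟨hz, _⟩ ⟨hz', _⟩; exact not_lt.2 (mem_Iic.1 hz) hz'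
    have e3 : γ.fst.real (Ioi s) = 1 - γ.fst.real (Iic s) := by
      rw [← probReal_compl_eq_one_sub measurableSet_Iic, compl_Iic]
    rw [Measure.prod_prod, hr γ.fst, hr γ.snd, ← ENNReal.ofReal_mul measureReal_nonneg, hr γ]
    refine ENNReal.ofReal_le_ofReal ?_
    rw [hr γ, hr γ.fst, hr γ, hr γ.fst (Iic s), ← ENNReal.ofReal_mul measureReal_nonneg,
      ← ENNReal.ofReal_mul measureReal_nonneg, ENNReal.ofReal_le_ofReal_iff (by positivity), e2, e3,
      e1] at hs
    nlinarith

/-! ### Quantile transforms -/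

theorem MeasureTheory.Measure.ext_prod_Iic {ρ γ : Measure (ℝ × ℝ)} [IsFiniteMeasure ρ]
    [IsFiniteMeasure γ] (h : ∀ s t, ρ (Iic s ×ˢ Iic t) = γ (Iic s ×ˢ Iic t)) : ρ = γ := by
  have e1 : ∀ (ρ : Measure (ℝ × ℝ)) (t : Set ℝ) {V : Set ℝ}, MeasurableSet V →
      (ρ.restrict (univ ×ˢ t)).fst V = ρ (V ×ˢ t) := fun ρ t V hV => by
    rw [Measure.fst_apply hV, Measure.restrict_apply (measurable_fst hV)]
    congr 1; ext z; simp
  have e2 : ∀ (ρ : Measure (ℝ × ℝ)) (s : Set ℝ) {V : Set ℝ}, MeasurableSet V →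
      (ρ.restrict (s ×ˢ univ)).snd V = ρ (s ×ˢ V) := fun ρ s V hV => by
    rw [Measure.snd_apply hV, Measure.restrict_apply (measurable_snd hV)]
    congr 1; ext z; simp [and_comm]
  have h1 : ∀ {V : Set ℝ} (t : ℝ), MeasurableSet V → ρ (V ×ˢ Iic t) = γ (V ×ˢ Iic t) := by
    intro V t hV
    rw [← e1 _ _ hV, ← e1 _ _ hV]
    congr 1
    refine Measure.ext_of_Iic _ _ fun s => ?_
    rw [e1 _ _ measurableSet_Iic, e1 _ _ measurableSet_Iic, h]
  refine Measure.ext_prod fun {V W} hV hW => ?_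
  rw [← e2 _ _ hW, ← e2 _ _ hW]
  congr 1
  refine Measure.ext_of_Iic _ _ fun s => ?_
  rw [e2 _ _ measurableSet_Iic, e2 _ _ measurableSet_Iic, h1 _ hV]

/-- Existence of a quantile function on the open unit interval. -/
theorem exists_quantile (α : Measure ℝ) [IsProbabilityMeasure α] :
    ∃ Q : ℝ → ℝ, Measurable Q ∧
      ∀ u ∈ Ioo (0 : ℝ) 1, ∀ t, Q u ≤ t ↔ u ≤ α.real (Iic t) := by
  classical
  -- Outside the open unit interval the infimum may be over an empty or unbounded set; the value 0
  -- there is arbitrary.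
  set Q : ℝ → ℝ := fun u => if u ∈ Ioo (0 : ℝ) 1 then sInf {t | u ≤ cdf α t} else 0 with hQ
  have gal : ∀ u ∈ Ioo (0 : ℝ) 1, ∀ t, Q u ≤ t ↔ u ≤ α.real (Iic t) := by
    intro u hu t
    rw [← cdf_eq_real]
    simp only [hQ, if_pos hu]
    have hbdd : BddBelow {t | u ≤ cdf α t} := by
      obtain ⟨b, hb⟩ := ((tendsto_cdf_atBot α).eventually (eventually_lt_nhds hu.1)).exists
      refine ⟨b, fun t ht => ?_⟩
      by_contra hlt
      exact absurd ((monotone_cdf α) (not_le.1 hlt).le) (not_le.2 (lt_of_lt_of_le hb ht))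
    have hne : {t | u ≤ cdf α t}.Nonempty := by
      obtain ⟨b, hb⟩ := ((tendsto_cdf_atTop α).eventually (eventually_gt_nhds hu.2)).exists
      exact ⟨b, hb.le⟩
    constructor
    · intro h
      have hright : ∀ t' > sInf {t | u ≤ cdf α t}, u ≤ cdf α t' := fun t' ht' => by
        obtain ⟨y, hy, hyt⟩ := exists_lt_of_csInf_lt hne ht'
        exact le_trans hy (monotone_cdf α hyt.le)
      have hcont := (cdf α).right_continuous (sInf {t | u ≤ cdf α t})
      have : u ≤ cdf α (sInf {t | u ≤ cdf α t}) := by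
        refine ge_of_tendsto (ContinuousWithinAt.tendsto (hcont.mono Ioi_subset_Ici_self)) ?_
        filter_upwards [self_mem_nhdsWithin] with t' ht'
        exact hright t' ht'
      exact this.trans (monotone_cdf α h)
    · intro h
      exact csInf_le hbdd h
  refine ⟨Q, ?_, gal⟩
  refine measurable_of_Iic fun t => ?_
  have : Q ⁻¹' Iic t = (Ioo 0 1 ∩ Iic (α.real (Iic t))) ∪ ((Ioo 0 1)ᶜ ∩ {_u | (0 : ℝ) ≤ t}) := by
    ext u
    by_cases hu : u ∈ Ioo (0 : ℝ) 1
    · simp only [mem_preimage, mem_Iic, gal u hu t, mem_union, mem_inter_iff, hu, mem_compl_iff,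
        true_and, not_true, false_and, or_false]
    · have : Q u = 0 := by simp only [hQ, if_neg hu]
      simp only [mem_preimage, mem_Iic, this, mem_union, mem_inter_iff, hu, mem_compl_iff,
        false_and, not_false_eq_true, true_and, false_or, mem_ofPred_eq]
  rw [this]
  exact (measurableSet_Ioo.inter measurableSet_Iic).union
    (measurableSet_Ioo.compl.inter (MeasurableSet.const _))

theorem ae_mem_Ioo_of_uniform {α : Measure ℝ} [IsProbabilityMeasure α]
    (h : ∀ u ∈ Icc (0 : ℝ) 1, α.real (Iic u) = u) : ∀ᵐ u ∂α, u ∈ Ioo (0 : ℝ) 1 := by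
  have h0 : α (Iic 0) = 0 := by
    have := h 0 (by simp)
    rwa [measureReal_eq_zero_iff] at this
  have h1 : α (Ici 1) = 0 := by
    rw [← measureReal_eq_zero_iff]
    refine le_antisymm (le_of_forall_pos_le_add fun ε hε => ?_) measureReal_nonneg
    have hm : (1 - min ε 1) ∈ Icc (0 : ℝ) 1 := by
      constructor
      · linarith [min_le_right ε 1]
      · linarith [lt_min hε one_pos]
    have hsub : Ici (1 : ℝ) ⊆ (Iic (1 - min ε 1))ᶜ := fun x hx => by
      simp only [mem_compl_iff, mem_Iic, not_le]
      linarith [lt_min hε one_pos, mem_Ici.1 hx]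
    refine (measureReal_mono hsub).trans ?_
    rw [probReal_compl_eq_one_sub measurableSet_Iic, h _ hm]
    linarith [min_le_left ε 1]
  filter_upwards [measure_eq_zero_iff_ae_notMem.1 h0, measure_eq_zero_iff_ae_notMem.1 h1]
    with u hu0 hu1
  exact ⟨by simpa using hu0, by simpa using hu1⟩

/-- Stochastic monotonicity passes from a copula to the laws it couples. -/
theorem SetwiseIncreasing.of_copula {γ ρ : Measure (ℝ × ℝ)} [IsProbabilityMeasure γ]
    [IsProbabilityMeasure ρ] (h1 : ∀ u ∈ Icc (0 : ℝ) 1, γ.fst.real (Iic u) = u)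
    (h2 : ∀ u ∈ Icc (0 : ℝ) 1, γ.snd.real (Iic u) = u)
    (hρ : ∀ s t, ρ.real (Iic s ×ˢ Iic t) =
      γ.real (Iic (ρ.fst.real (Iic s)) ×ˢ Iic (ρ.snd.real (Iic t))))
    (hγ : SetwiseIncreasing γ) : SetwiseIncreasing ρ := by
  obtain ⟨Q, hQm, hQ⟩ := exists_quantile ρ.fst
  obtain ⟨R, hRm, hR⟩ := exists_quantile ρ.snd
  have hae1 : ∀ᵐ z ∂γ, z.1 ∈ Ioo (0 : ℝ) 1 :=
    ae_of_ae_map (f := Prod.fst) measurable_fst.aemeasurable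
      (ae_mem_Ioo_of_uniform (α := γ.fst) h1)
  have hae2 : ∀ᵐ z ∂γ, z.2 ∈ Ioo (0 : ℝ) 1 :=
    ae_of_ae_map (f := Prod.snd) measurable_snd.aemeasurable
      (ae_mem_Ioo_of_uniform (α := γ.snd) h2)
  have hQR : Measurable (Prod.map Q R) := hQm.prodMap hRm
  -- The coupled law is the image of the copula law under the pair of quantile functions.
  have hlaw : ρ = γ.map (Prod.map Q R) := by
    have : IsProbabilityMeasure (γ.map (Prod.map Q R)) :=
      Measure.isProbabilityMeasure_map hQR.aemeasurable
    refine Measure.ext_prod_Iic fun s t => ?_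
    rw [Measure.map_apply hQR (measurableSet_Iic.prod measurableSet_Iic)]
    refine (measureReal_eq_measureReal_iff).1 ?_
    rw [hρ]
    refine measureReal_congr (Filter.eventuallyEq_set.2 ?_)
    filter_upwards [hae1, hae2] with z hz1 hz2
    simp only [mem_prod, mem_Iic, mem_preimage, Prod.map_fst, Prod.map_snd, hQ _ hz1, hR _ hz2]
  have hA : ∀ {A : Set ℝ}, MeasurableSet A → ∀ t, ρ (A ×ˢ Ioi t) =
      γ ((Q ⁻¹' A ∩ Ioo 0 1) ×ˢ Ioi (ρ.snd.real (Iic t))) := by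
    intro A hA t
    conv_lhs => rw [hlaw]
    rw [Measure.map_apply hQR (hA.prod measurableSet_Ioi)]
    refine measure_congr (Filter.eventuallyEq_set.2 ?_)
    filter_upwards [hae1, hae2] with z hz1 hz2
    simp only [mem_prod, mem_Ioi, mem_preimage, Prod.map_fst, Prod.map_snd, mem_inter_iff, hz1,
      and_true, ← not_le, hR _ hz2]
  have hF : ∀ {A : Set ℝ}, MeasurableSet A → ρ.fst A = γ.fst (Q ⁻¹' A ∩ Ioo 0 1) := by
    intro A hA
    rw [Measure.fst_apply hA, Measure.fst_apply ((hQm hA).inter measurableSet_Ioo)]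
    conv_lhs => rw [hlaw]
    rw [Measure.map_apply hQR (measurable_fst hA)]
    refine measure_congr (Filter.eventuallyEq_set.2 ?_)
    filter_upwards [hae1] with z hz1
    simp only [mem_preimage, Prod.map_fst, mem_inter_iff, hz1, and_true]
  intro A A' hAm hA'm hlt t
  rw [hA hAm, hA hA'm, hF hAm, hF hA'm]
  refine hγ ((hQm hAm).inter measurableSet_Ioo) ((hQm hA'm).inter measurableSet_Ioo) ?_ _
  -- `Q` is monotone on the unit interval, so preimages of strictly separated sets are strictly
  -- separated.
  rintro u ⟨huA, hu⟩ u' ⟨hu'A, hu'⟩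
  have h := hlt _ huA _ hu'A
  by_contra hle
  refine absurd h (not_lt.2 ?_)
  rw [hQ _ hu']
  exact (not_lt.1 hle).trans ((hQ _ hu _).1 le_rfl)

/-- Any law with the distribution function of a copula has uniform marginals. -/
theorem Copula.uniform_of_hasDF (C : Copula) {γ : Measure (ℝ × ℝ)} [IsProbabilityMeasure γ]
    (hγ : HasDF γ C.toFun) :
    (∀ u ∈ Icc (0 : ℝ) 1, γ.fst.real (Iic u) = u) ∧
      ∀ u ∈ Icc (0 : ℝ) 1, γ.snd.real (Iic u) = u := by
  obtain ⟨γ₀, _, hf, hs, h₀⟩ := C.exists_law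
  -- A copula prescribes values on the unit square only. The value 1 at `(1, 1)` confines the mass
  -- to `Iic 1 ×ˢ Iic 1`, so marginals are read off by setting the other argument to 1.
  have hone : ∀ γ : Measure (ℝ × ℝ), IsProbabilityMeasure γ → γ.real (Iic 1 ×ˢ Iic 1) = 1 →
      (∀ u, γ.fst.real (Iic u) = γ.real (Iic u ×ˢ Iic 1)) ∧
      (∀ u, γ.snd.real (Iic u) = γ.real (Iic 1 ×ˢ Iic u)) := by
    intro γ _ h
    have hae : ∀ᵐ z ∂γ, z ∈ Iic (1 : ℝ) ×ˢ Iic (1 : ℝ) := by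
      refine (mem_ae_iff_prob_eq_one (measurableSet_Iic.prod measurableSet_Iic)).2 ?_
      rw [← ofReal_measureReal (measure_ne_top _ _), h, ENNReal.ofReal_one]
    constructor
    · intro u
      rw [measureReal_def, Measure.fst_apply measurableSet_Iic, ← measureReal_def]
      refine measureReal_congr (Filter.eventuallyEq_set.2 ?_)
      filter_upwards [hae] with z hz
      simp only [mem_preimage, mem_prod, mem_Iic] at hz ⊢
      simp [hz.2]
    · intro u
      rw [measureReal_def, Measure.snd_apply measurableSet_Iic, ← measureReal_def]
      refine measureReal_congr (Filter.eventuallyEq_set.2 ?_)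
      filter_upwards [hae] with z hz
      simp only [mem_preimage, mem_prod, mem_Iic] at hz ⊢
      simp [hz.1]
  have hu : ∀ u ∈ Icc (0 : ℝ) 1, (volume.restrict (Icc (0 : ℝ) 1)).real (Iic u) = u := by
    intro u hu
    rw [measureReal_restrict_apply measurableSet_Iic]
    have : Iic u ∩ Icc 0 1 = Icc 0 u := by
      ext x; simp only [mem_inter_iff, mem_Iic, mem_Icc]
      exact ⟨fun h => ⟨h.2.1, h.1⟩, fun h => ⟨h.2, h.1, h.2.trans hu.2⟩⟩
    rw [this, Real.volume_real_Icc_of_le hu.1, sub_zero]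
  have h11 : γ₀.real (Iic 1 ×ˢ Iic 1) = 1 := by
    have hae1 : ∀ᵐ z ∂γ₀, z.1 ∈ Icc (0 : ℝ) 1 := by
      refine ae_of_ae_map (f := Prod.fst) measurable_fst.aemeasurable ?_
      rw [← Measure.fst, hf]; exact ae_restrict_mem measurableSet_Icc
    have hae2 : ∀ᵐ z ∂γ₀, z.2 ∈ Icc (0 : ℝ) 1 := by
      refine ae_of_ae_map (f := Prod.snd) measurable_snd.aemeasurable ?_
      rw [← Measure.snd, hs]; exact ae_restrict_mem measurableSet_Icc
    rw [← probReal_univ (μ := γ₀)]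
    refine measureReal_congr (Filter.eventuallyEq_set.2 ?_)
    filter_upwards [hae1, hae2] with z h1 h2
    simp [Prod.le_def, h1.2, h2.2]
  have e := fun u v : I => (hγ u v).trans (h₀ u v).symm
  have h11' : γ.real (Iic 1 ×ˢ Iic 1) = 1 := by
    refine Eq.trans ?_ h11
    exact e 1 1
  constructor
  · intro u hu'
    have := e ⟨u, hu'⟩ 1
    simp only [Set.Icc.coe_one] at this
    rw [(hone γ inferInstance h11').1, this, ← (hone γ₀ inferInstance h11).1, hf, hu u hu']
  · intro u hu'
    have := e 1 ⟨u, hu'⟩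
    simp only [Set.Icc.coe_one] at this
    rw [(hone γ inferInstance h11').2, this, ← (hone γ₀ inferInstance h11).2, hs, hu u hu']

/-! ### Monotone kernels -/

/-- A kernel on the line that is increasing in the usual stochastic order. -/
def MonotoneKernel (K : Kernel ℝ ℝ) : Prop :=
  ∀ ⦃s s' : ℝ⦄, s ≤ s' → ∀ t, K s (Ioi t) ≤ K s' (Ioi t)

theorem MonotoneKernel.integral_mono {K : Kernel ℝ ℝ} [IsMarkovKernel K] (hK : MonotoneKernel K)
    {g : ℝ → ℝ} (hg : Monotone g) {c : ℝ} (hc : ∀ x, |g x| ≤ c) :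
    Monotone fun s => ∫ y, g y ∂K s := fun _ _ hs =>
  hg.integral_le_of_Ioi (by simp) (hK hs) hc

/-- The kernel `K` agrees with monotone kernels off sets of arbitrarily small measure. -/
def NearlyMonotone (α : Measure ℝ) (K : Kernel ℝ ℝ) : Prop :=
  ∀ ε : ℝ, 0 < ε → ∃ K' : Kernel ℝ ℝ, IsMarkovKernel K' ∧ MonotoneKernel K' ∧
    ∃ S, MeasurableSet S ∧ α.real Sᶜ ≤ ε ∧ ∀ s ∈ S, K' s = K s

/-- If monotonicity fails at `s < s'`, rationals `q < q'` and `a` put `s` into a set left of `a`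
where the tail probability is at least `q'`, and `s'` into one right of `a` where it is at most `q`.
The product inequality forbids that both have positive measure, so discarding the countably many
null sets of these kinds suffices. -/
theorem SetwiseIncreasing.ae_le_condKernel {γ : Measure (ℝ × ℝ)} [IsProbabilityMeasure γ]
    (h : SetwiseIncreasing γ) : ∃ T, γ.fst Tᶜ = 0 ∧ MeasurableSet T ∧
      ∀ s ∈ T, ∀ s' ∈ T, s ≤ s' → ∀ t, γ.condKernel s (Ioi t) ≤ γ.condKernel s' (Ioi t) := by
  set K := γ.condKernel with hK
  set A : ℚ → ℚ → ℚ → Set ℝ := fun t a q =>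
    {s | ENNReal.ofReal q ≤ K s (Ioi (t : ℝ))} ∩ Iio (a : ℝ) with hA
  set A' : ℚ → ℚ → ℚ → Set ℝ := fun t a q =>
    {s | K s (Ioi (t : ℝ)) ≤ ENNReal.ofReal q} ∩ Ici (a : ℝ) with hA'
  have hKm : ∀ t : ℝ, Measurable fun s => K s (Ioi t) := fun t =>
    Kernel.measurable_coe K measurableSet_Ioi
  have hAm : ∀ t a q, MeasurableSet (A t a q) := fun t a q =>
    (measurableSet_le measurable_const (hKm t)).inter measurableSet_Iio
  have hAm' : ∀ t a q, MeasurableSet (A' t a q) := fun t a q =>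
    (measurableSet_le (hKm t) measurable_const).inter measurableSet_Ici
  have hcontra : ∀ t a q q', q < q' → 0 < q' → γ.fst (A t a q') ≠ 0 →
      γ.fst (A' t a q) = 0 := by
    intro t a q q' hq hq0 hne
    by_contra hne'
    have hs := h (hAm t a q') (hAm' t a q)
      (fun x hx y hy => lt_of_lt_of_le (mem_Iio.1 hx.2) (mem_Ici.1 hy.2)) t
    rw [← Measure.setLIntegral_condKernel_eq_measure_prod (hAm _ _ _) measurableSet_Ioi,
      ← Measure.setLIntegral_condKernel_eq_measure_prod (hAm' _ _ _) measurableSet_Ioi] at hs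
    have h1 : ENNReal.ofReal q' * γ.fst (A t a q') ≤ ∫⁻ u in A t a q', K u (Ioi t) ∂γ.fst := by
      rw [← setLIntegral_const]
      exact setLIntegral_mono' (hAm _ _ _) fun u hu => hu.1
    have h2 : ∫⁻ u in A' t a q, K u (Ioi t) ∂γ.fst ≤ ENNReal.ofReal q * γ.fst (A' t a q) := by
      rw [← setLIntegral_const]
      exact setLIntegral_mono' (hAm' _ _ _) fun u hu => hu.1
    have h3 : ENNReal.ofReal q' * (γ.fst (A t a q') * γ.fst (A' t a q)) ≤
        ENNReal.ofReal q * (γ.fst (A t a q') * γ.fst (A' t a q)) := by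
      calc _ = ENNReal.ofReal q' * γ.fst (A t a q') * γ.fst (A' t a q) := by ring
        _ ≤ _ := (mul_le_mul_left h1 _)
        _ ≤ _ := hs
        _ ≤ _ := (mul_le_mul_left h2 _)
        _ = _ := by ring
    rw [ENNReal.mul_le_mul_iff_left (mul_ne_zero hne hne')
      (ENNReal.mul_ne_top (measure_ne_top _ _) (measure_ne_top _ _))] at h3
    refine absurd h3 (not_le.2 ?_)
    exact (ENNReal.ofReal_lt_ofReal_iff (by exact_mod_cast hq0)).2 (by exact_mod_cast hq)
  have hae : ∀ B : Set ℝ, ∀ᵐ s ∂γ.fst, s ∈ B → γ.fst B ≠ 0 := fun B => by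
    by_cases hB : γ.fst B = 0
    · filter_upwards [measure_eq_zero_iff_ae_notMem.1 hB] with s hs hsB
      exact absurd hsB hs
    · exact Filter.Eventually.of_forall fun s _ => hB
  have hall : ∀ᵐ s ∂γ.fst, ∀ t a q, (s ∈ A t a q → γ.fst (A t a q) ≠ 0) ∧
      (s ∈ A' t a q → γ.fst (A' t a q) ≠ 0) := by
    simp only [ae_all_iff]
    exact fun t a q => (hae _).and (hae _)
  obtain ⟨Z, hsub, hZm, hZ⟩ := exists_measurable_superset_of_null (ae_iff.1 hall)
  refine ⟨Zᶜ, by simpa using hZ, hZm.compl, ?_⟩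
  have hgood : ∀ s ∈ Zᶜ, ∀ t a q, (s ∈ A t a q → γ.fst (A t a q) ≠ 0) ∧
      (s ∈ A' t a q → γ.fst (A' t a q) ≠ 0) := fun s hs => by
    by_contra hc
    exact hs (hsub hc)
  intro s hs s' hs' hss
  rcases hss.eq_or_lt with rfl | hlt
  · exact fun t => le_rfl
  have hrat : ∀ t : ℚ, K s (Ioi (t : ℝ)) ≤ K s' (Ioi (t : ℝ)) := by
    intro t
    by_contra hgt
    rw [not_le] at hgt
    obtain ⟨q, hq0, hq1, hq2⟩ := ENNReal.lt_iff_exists_rat_btwn.1 hgt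
    obtain ⟨q', hq0', hq1', hq2'⟩ := ENNReal.lt_iff_exists_rat_btwn.1 hq2
    obtain ⟨a, ha, ha'⟩ := exists_rat_btwn hlt
    have hqq : (q : ℝ) < q' := by
      by_contra hle
      exact absurd hq1' (not_lt.2 (ENNReal.ofReal_le_ofReal (not_lt.1 hle)))
    refine absurd (hcontra t a q q' (by exact_mod_cast hqq) ?_ ?_) ?_
    · have : (0 : ℝ) < q' := lt_of_le_of_lt (by exact_mod_cast hq0) hqq
      exact_mod_cast this
    · exact ((hgood s hs) t a q').1 ⟨hq2'.le, ha⟩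
    · exact ((hgood s' hs') t a q).2 ⟨hq1.le, ha'.le⟩
  intro t
  have hunion : Ioi t = ⋃ q : {q : ℚ // t < q}, Ioi ((q : ℚ) : ℝ) := by
    ext x
    simp only [mem_Ioi, mem_iUnion, Subtype.exists, exists_prop]
    constructor
    · intro hx
      obtain ⟨q, h1, h2⟩ := exists_rat_btwn hx
      exact ⟨q, h1, h2⟩
    · rintro ⟨q, h1, h2⟩
      exact h1.trans h2
  have hdir : Directed (· ⊆ ·) fun q : {q : ℚ // t < q} => Ioi ((q : ℚ) : ℝ) := by
    refine Antitone.directed_le fun q q' hqq => Ioi_subset_Ioi ?_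
    exact_mod_cast hqq
  rw [hunion, hdir.measure_iUnion, hdir.measure_iUnion]
  exact iSup_mono fun q => hrat q

/-- Precomposing the kernel with a monotone retraction onto a compact part of the good set `T` makes
it increasing everywhere. Its values are still values of the original kernel, hence probability
measures. -/
theorem SetwiseIncreasing.nearlyMonotone {γ : Measure (ℝ × ℝ)} [IsProbabilityMeasure γ]
    (h : SetwiseIncreasing γ) : NearlyMonotone γ.fst γ.condKernel := by
  obtain ⟨T, hT0, hTm, hT⟩ := h.ae_le_condKernel
  intro ε hε
  have hne : T.Nonempty := by
    rw [nonempty_iff_ne_empty]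
    rintro rfl
    simp at hT0
  obtain ⟨t₀, ht₀⟩ := hne
  obtain ⟨C, hCT, hC, hlt⟩ := hTm.exists_isCompact_sdiff_lt (measure_ne_top γ.fst T)
    (ENNReal.ofReal_pos.2 hε).ne'
  obtain ⟨π, hπm, hπC, hπ⟩ := (hC.insert t₀).exists_monotone_retraction ⟨t₀, mem_insert _ _⟩
  have hπT : ∀ t, π t ∈ T := fun t => insert_subset ht₀ hCT (hπC t)
  refine ⟨γ.condKernel.comap π hπm.measurable, inferInstance, ?_, C, hC.measurableSet, ?_, ?_⟩
  · intro s s' hs t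
    rw [Kernel.comap_apply, Kernel.comap_apply]
    exact hT _ (hπT s) _ (hπT s') (hπm hs) t
  · refine ENNReal.toReal_le_of_le_ofReal hε.le ?_
    calc γ.fst Cᶜ ≤ γ.fst (Tᶜ ∪ T \ C) := measure_mono fun x hx => by
          by_cases hxT : x ∈ T
          · exact Or.inr ⟨hxT, hx⟩
          · exact Or.inl hxT
      _ ≤ γ.fst Tᶜ + γ.fst (T \ C) := measure_union_le _ _
      _ ≤ _ := by rw [hT0, zero_add]; exact hlt.le
  · intro s hs
    rw [Kernel.comap_apply, hπ s (mem_insert_of_mem _ hs)]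

/-! ### Integrating out one coordinate -/

section Step

variable {N : Type*} [DecidableEq N]

open Function

/-- Conditional expectation of `g` when the coordinate `j` is resampled from the kernel `K`
started at the coordinate `p`. -/
noncomputable def resample (K : Kernel ℝ ℝ) (p j : N) (g : (N → ℝ) → ℝ) (x : N → ℝ) : ℝ :=
  ∫ y, g (update x j y) ∂K (x p)

theorem abs_integral_le_of_forall_abs_le {α : Type*} [MeasurableSpace α] {μ : Measure α}
    [IsProbabilityMeasure μ] {f : α → ℝ} {c : ℝ} (hc : ∀ x, |f x| ≤ c) : |∫ x, f x ∂μ| ≤ c := by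
  have := norm_integral_le_of_norm_le_const (μ := μ) (f := f) (C := c)
    (Filter.Eventually.of_forall hc)
  simpa using this

theorem abs_integral_sub_le_of_eq_off {α : Type*} [MeasurableSpace α] {μ : Measure α}
    [IsProbabilityMeasure μ] {f g : α → ℝ} (hf : Measurable f) (hg : Measurable g) {c : ℝ}
    (hfc : ∀ x, |f x| ≤ c) (hgc : ∀ x, |g x| ≤ c) {S : Set α} (hS : MeasurableSet S)
    {ε : ℝ} (hε : μ.real Sᶜ ≤ ε) (h : ∀ x ∈ S, f x = g x) :
    |∫ x, f x ∂μ - ∫ x, g x ∂μ| ≤ 2 * c * ε := by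
  have hc : 0 ≤ c := by
    obtain ⟨x⟩ : Nonempty α := μ.nonempty_of_neZero
    exact (abs_nonneg _).trans (hfc x)
  rw [← integral_sub (hf.integrable_of_abs_le hfc) (hg.integrable_of_abs_le hgc)]
  calc |∫ x, (f x - g x) ∂μ| ≤ ∫ x, |f x - g x| ∂μ := abs_integral_le_integral_abs
    _ ≤ ∫ x, Sᶜ.indicator (fun _ => 2 * c) x ∂μ := by
        refine integral_mono ?_ ((integrable_const _).indicator hS.compl) fun x => ?_
        · exact ((hf.integrable_of_abs_le hfc).sub (hg.integrable_of_abs_le hgc)).abs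
        · by_cases hx : x ∈ S
          · simp [hx, h x hx]
          · rw [indicator_of_mem (by simpa using hx)]
            exact (abs_sub _ _).trans (by linarith [hfc x, hgc x])
    _ = 2 * c * μ.real Sᶜ := by
        rw [integral_indicator_const _ hS.compl, smul_eq_mul, mul_comm]
    _ ≤ 2 * c * ε := by gcongr

theorem update_mono_both {x x' : N → ℝ} (h : x ≤ x') (j : N) {y y' : ℝ} (hy : y ≤ y') :
    update x j y ≤ update x' j y' :=
  update_le_update_iff.2 ⟨hy, fun i _ => h i⟩

theorem DependsOn.resample {K : Kernel ℝ ℝ} {p j : N} {g : (N → ℝ) → ℝ} {A : Finset N}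
    (hp : p ∈ A)
    (hg : DependsOn g (↑(insert j A) : Set N)) :
    DependsOn (resample K p j g) (↑A : Set N) := by
  intro x x' h
  simp only [_root_.resample, h p hp]
  congr 1
  ext y
  refine hg fun i hi => ?_
  by_cases hij : i = j
  · subst hij; simp
  · rw [update_of_ne hij, update_of_ne hij]
    exact h i (by simpa [hij] using hi)

variable {K : Kernel ℝ ℝ} [IsMarkovKernel K] {p j : N} {g : (N → ℝ) → ℝ} {c : ℝ}

theorem measurable_resample (hg : Measurable g) : Measurable (resample K p j g) := by
  have h : StronglyMeasurable (uncurry fun (x : N → ℝ) (y : ℝ) => g (update x j y)) :=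
    (hg.comp measurable_update').stronglyMeasurable
  exact (h.integral_kernel_prod_right (κ := K.comap (fun x : N → ℝ => x p)
    (measurable_pi_apply p))).measurable

theorem abs_resample_le (hc : ∀ x, |g x| ≤ c) (x : N → ℝ) : |resample K p j g x| ≤ c :=
  abs_integral_le_of_forall_abs_le fun _ => hc _

theorem Monotone.resample (hK : MonotoneKernel K) (hgm : Measurable g) (hc : ∀ x, |g x| ≤ c)
    (hg : Monotone g) : Monotone (resample K p j g) := by
  intro x x' h
  have hm : ∀ x : N → ℝ, Measurable fun y => g (update x j y) := fun x =>
    hgm.comp (measurable_update x)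
  calc ∫ y, g (update x j y) ∂K (x p) ≤ ∫ y, g (update x' j y) ∂K (x p) :=
        integral_mono ((hm x).integrable_of_abs_le fun _ => hc _)
          ((hm x').integrable_of_abs_le fun _ => hc _) fun y => hg (update_mono_both h j le_rfl)
    _ ≤ ∫ y, g (update x' j y) ∂K (x' p) :=
        hK.integral_mono (fun y y' hy => hg (update_mono_both le_rfl j hy)) (fun _ => hc _) (h p)

theorem Supermodular.update_le (hg : Supermodular g) {x x' : N → ℝ} (h : x ≤ x') {y y' : ℝ}
    (hy : y ≤ y') : g (update x j y') - g (update x j y) ≤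
      g (update x' j y') - g (update x' j y) := by
  have hinf : update x j y' ⊓ update x' j y = update x j y := by
    ext i
    by_cases hi : i = j
    · subst hi; simpa using hy
    · simpa [hi] using h i
  have hsup : update x j y' ⊔ update x' j y = update x' j y' := by
    ext i
    by_cases hi : i = j
    · subst hi; simpa using hy
    · simpa [hi] using h i
  have := hg (update x j y') (update x' j y)
  rw [hinf, hsup] at this
  linarith

/-- Let `x p ≤ x' p`. At fixed `y`, the increment of `g` from `x ⊓ x'` to `x` is at most that from
`x'` to `x ⊔ x'`. The latter is increasing in `y`, so its mean grows from `K (x p)` to `K (x' p)`,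
and these are the laws belonging to the meet and the join. -/
theorem Supermodular.resample (hK : MonotoneKernel K) (hgm : Measurable g) (hc : ∀ x, |g x| ≤ c)
    (hg : Supermodular g) : Supermodular (resample K p j g) := by
  have hi : ∀ (x : N → ℝ) s, Integrable (fun y => g (update x j y)) (K s) := fun x s =>
    (hgm.comp (measurable_update x)).integrable_of_abs_le fun _ => hc _
  have key : ∀ x x' : N → ℝ, x p ≤ x' p → _root_.resample K p j g x + _root_.resample K p j g x' ≤
      _root_.resample K p j g (x ⊓ x') + _root_.resample K p j g (x ⊔ x') := by
    intro x x' h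
    have hinf : (x ⊓ x') p = x p := by simpa using h
    have hsup : (x ⊔ x') p = x' p := by simpa using h
    simp only [_root_.resample, hinf, hsup]
    have h1 : ∫ y, (g (update (x ⊔ x') j y) - g (update x' j y)) ∂K (x p) ≤
        ∫ y, (g (update (x ⊔ x') j y) - g (update x' j y)) ∂K (x' p) := by
      refine hK.integral_mono (c := c + c) (fun y y' hy => ?_)
        (fun y => (abs_sub _ _).trans (add_le_add (hc _) (hc _))) h
      have := hg.update_le (j := j) (le_sup_right : x' ≤ x ⊔ x') hy
      linarith
    have h2 : ∫ y, (g (update x j y) - g (update (x ⊓ x') j y)) ∂K (x p) ≤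
        ∫ y, (g (update (x ⊔ x') j y) - g (update x' j y)) ∂K (x p) := by
      refine integral_mono ((hi _ _).sub (hi _ _)) ((hi _ _).sub (hi _ _)) fun y => ?_
      have := hg (update x j y) (update x' j y)
      have e1 : update x j y ⊓ update x' j y = update (x ⊓ x') j y := by
        ext i; by_cases h : i = j
        · subst h; simp
        · simp [h]
      have e2 : update x j y ⊔ update x' j y = update (x ⊔ x') j y := by
        ext i; by_cases h : i = j
        · subst h; simp
        · simp [h]
      rw [e1, e2] at this
      simp only; linarith
    rw [integral_sub (hi _ _) (hi _ _), integral_sub (hi _ _) (hi _ _)] at h1 h2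
    linarith
  intro x x'
  rcases le_total (x p) (x' p) with h | h
  · exact key x x' h
  · rw [add_comm, inf_comm, sup_comm]; exact key x' x h

theorem abs_integral_resample_sub_le {μ : Measure (N → ℝ)} [IsProbabilityMeasure μ]
    {K' : Kernel ℝ ℝ} [IsMarkovKernel K'] (hg : Measurable g) (hc : ∀ x, |g x| ≤ c) {S : Set ℝ}
    (hS : MeasurableSet S) {ε : ℝ} (hε : (μ.map fun x => x p).real Sᶜ ≤ ε)
    (h : ∀ s ∈ S, K' s = K s) :
    |∫ x, resample K' p j g x ∂μ - ∫ x, resample K p j g x ∂μ| ≤ 2 * c * ε := by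
  refine abs_integral_sub_le_of_eq_off (measurable_resample hg) (measurable_resample hg)
    (abs_resample_le hc) (abs_resample_le hc) (measurable_pi_apply p hS) ?_ fun x hx => ?_
  · rwa [map_measureReal_apply (measurable_pi_apply p) hS.compl] at hε
  · simp only [resample, h _ hx]

end Step

/-! ### Stochastically increasing conditional laws and the comparison along a tree -/

section Tree

variable {N : Type*}

open Function

/-- The law of the coordinates `(i, j)`. -/
noncomputable def pairLaw (μ : Measure (N → ℝ)) (i j : N) : Measure (ℝ × ℝ) :=
  μ.map fun x => (x i, x j)

theorem measurable_pair (i j : N) : Measurable fun x : N → ℝ => (x i, x j) :=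
  (measurable_pi_apply i).prodMk (measurable_pi_apply j)

instance (μ : Measure (N → ℝ)) [IsProbabilityMeasure μ] (i j : N) :
    IsProbabilityMeasure (pairLaw μ i j) :=
  Measure.isProbabilityMeasure_map (measurable_pair i j).aemeasurable

instance (μ : Measure (N → ℝ)) [IsProbabilityMeasure μ] (i : N) :
    IsProbabilityMeasure (μ.map fun x => x i) :=
  Measure.isProbabilityMeasure_map (measurable_pi_apply i).aemeasurable

theorem fst_pairLaw (μ : Measure (N → ℝ)) (i j : N) : (pairLaw μ i j).fst = μ.map fun x => x i :=
  Measure.fst_map_prodMk (measurable_pi_apply j)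

theorem snd_pairLaw (μ : Measure (N → ℝ)) (i j : N) : (pairLaw μ i j).snd = μ.map fun x => x j :=
  Measure.snd_map_prodMk (measurable_pi_apply i)

theorem map_swap_pairLaw (μ : Measure (N → ℝ)) (i j : N) :
    (pairLaw μ i j).map Prod.swap = pairLaw μ j i :=
  Measure.map_map measurable_swap (measurable_pair i j)

theorem integral_pairLaw (μ : Measure (N → ℝ)) [IsProbabilityMeasure μ] (i j : N)
    {h : ℝ × ℝ → ℝ} (hh : Measurable h) {c : ℝ} (hc : ∀ z, |h z| ≤ c) :
    ∫ z, h z ∂pairLaw μ i j =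
      ∫ s, ∫ t, h (s, t) ∂(pairLaw μ i j).condKernel s ∂μ.map fun x => x i := by
  rw [← fst_pairLaw μ i j, ← Measure.integral_compProd, Measure.disintegrate]
  exact hh.integrable_of_abs_le hc

theorem measurableSet_coord_eq (i : N) (s : ℝ) : MeasurableSet {x : N → ℝ | x i = s} :=
  measurableSet_eq_fun (measurable_pi_apply i) measurable_const

theorem dependsOn_singleton_integral {r : N} {ψ : (N → ℝ) → ℝ} (hψ : Measurable ψ)
    (hdep : DependsOn ψ (↑({r} : Finset N) : Set N)) (μ : Measure (N → ℝ)) :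
    ∫ x, ψ x ∂μ = ∫ s, ψ (fun _ => s) ∂μ.map fun x => x r := by
  rw [integral_map (measurable_pi_apply r).aemeasurable]
  · refine integral_congr_ae (Filter.Eventually.of_forall fun x => hdep fun i hi => ?_)
    simp only [Finset.coe_singleton, mem_singleton_iff] at hi
    rw [hi]
  · exact (hψ.comp (measurable_pi_lambda _ fun _ => measurable_id)).aestronglyMeasurable

/-- The coordinates in `A` are stochastically increasing in the coordinate `p`, up to `ε`: the
law of the subvector is approximated in total variation by a mixture of increasing laws. -/
structure IsMonotoneConditional (μ : Measure (N → ℝ)) (A : Finset N) (p : N) (ε : ℝ)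
    (κ : Kernel ℝ (N → ℝ)) : Prop where
  ae_eq : ∀ s, ∀ᵐ x ∂κ s, x p = s
  mono : ∀ (φ : (N → ℝ) → ℝ) (c : ℝ), Measurable φ → (∀ x, |φ x| ≤ c) → Monotone φ →
    Monotone fun s => ∫ x, φ x ∂κ s
  approx : ∀ ψ : (N → ℝ) → ℝ, Measurable ψ → (∀ x, |ψ x| ≤ 1) → DependsOn ψ (↑A : Set N) →
    |∫ x, ψ x ∂μ - ∫ s, ∫ x, ψ x ∂κ s ∂μ.map fun x => x p| ≤ ε

theorem isMonotoneConditional_singleton (μ : Measure (N → ℝ)) (r : N) {ε : ℝ} (hε : 0 ≤ ε) :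
    IsMonotoneConditional μ {r} r ε
      (Kernel.deterministic (fun s (_ : N) => s)
        (measurable_pi_lambda _ fun _ => measurable_id)) where
  ae_eq s := by
    rw [Kernel.deterministic_apply]
    exact (ae_dirac_iff (measurableSet_coord_eq r s)).2 rfl
  mono φ c hφ _ hmono s s' hs := by
    simp only [Kernel.deterministic_apply]
    rw [integral_dirac' _ _ hφ.stronglyMeasurable, integral_dirac' _ _ hφ.stronglyMeasurable]
    exact hmono fun _ => hs
  approx ψ hψ _ hdep := by
    rw [dependsOn_singleton_integral hψ hdep]
    simp only [Kernel.deterministic_apply]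
    simp only [integral_dirac' _ _ hψ.stronglyMeasurable, sub_self, abs_zero, hε]

variable [DecidableEq N]

/-- The coordinate `j` depends on the coordinates in `A` only through the coordinate `p`. -/
def MarkovStep (μ : Measure (N → ℝ)) [IsProbabilityMeasure μ] (A : Finset N) (p j : N) : Prop :=
  ∀ (g : (N → ℝ) → ℝ) (c : ℝ), Measurable g → (∀ x, |g x| ≤ c) →
    DependsOn g (↑(insert j A) : Set N) →
      ∫ x, g x ∂μ = ∫ x, resample (pairLaw μ p j).condKernel p j g x ∂μ

/-- Averages of `ψ` over the laws `κ s`, with the coordinate `j` set to a given value. -/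
noncomputable def sliceAverage (κ : Kernel ℝ (N → ℝ)) (j : N) (ψ : (N → ℝ) → ℝ) (z : ℝ × ℝ) : ℝ :=
  ∫ x, ψ (update x j z.2) ∂κ z.1

variable {μ : Measure (N → ℝ)} {A : Finset N} {p j : N} {ε : ℝ}
  {κ : Kernel ℝ (N → ℝ)} [IsMarkovKernel κ] {ψ : (N → ℝ) → ℝ}

theorem measurable_sliceAverage (hψ : Measurable ψ) : Measurable (sliceAverage κ j ψ) := by
  have h : StronglyMeasurable (uncurry fun (z : ℝ × ℝ) (x : N → ℝ) => ψ (update x j z.2)) :=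
    (hψ.comp (measurable_update'.comp (measurable_snd.prodMk
      (measurable_snd.comp measurable_fst)))).stronglyMeasurable
  exact (h.integral_kernel_prod_right (κ := κ.comap Prod.fst measurable_fst)).measurable

theorem abs_sliceAverage_le {c : ℝ} (hc : ∀ x, |ψ x| ≤ c) (z : ℝ × ℝ) :
    |sliceAverage κ j ψ z| ≤ c :=
  abs_integral_le_of_forall_abs_le fun _ => hc _

/-- Under `κ s` the coordinate `p` equals `s`, so resampling uses the single law `K s` and Fubini
applies. -/
theorem integral_resample_eq (hκ : ∀ s, ∀ᵐ x ∂κ s, x p = s) {K : Kernel ℝ ℝ} [IsMarkovKernel K]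
    (hψ : Measurable ψ) {c : ℝ} (hc : ∀ x, |ψ x| ≤ c) (s : ℝ) :
    ∫ x, resample K p j ψ x ∂κ s = ∫ t, sliceAverage κ j ψ (s, t) ∂K s := by
  have h1 : ∫ x, resample K p j ψ x ∂κ s = ∫ x, ∫ t, ψ (update x j t) ∂K s ∂κ s := by
    refine integral_congr_ae ?_
    filter_upwards [hκ s] with x hx
    rw [resample, hx]
  rw [h1, integral_integral_swap]
  · rfl
  · exact (hψ.comp measurable_update').integrable_of_abs_le fun _ => hc _

theorem IsMonotoneConditional.abs_integral_resample_sub_le (hκ : IsMonotoneConditional μ A p ε κ)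
    (hp : p ∈ A) {K : Kernel ℝ ℝ} [IsMarkovKernel K] (hψ : Measurable ψ) (hc : ∀ x, |ψ x| ≤ 1)
    (hdep : DependsOn ψ (↑(insert j A) : Set N)) :
    |∫ x, resample K p j ψ x ∂μ -
      ∫ s, ∫ t, sliceAverage κ j ψ (s, t) ∂K s ∂μ.map fun x => x p| ≤ ε := by
  have := hκ.approx _ (measurable_resample (K := K) hψ) (abs_resample_le hc) (hdep.resample hp)
  simpa only [integral_resample_eq hκ.ae_eq hψ hc] using this

/-- By supermodularity, an increment of `ψ` in coordinate `j` is increasing in the other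
coordinates, so its mean under `κ s` increases with `s`. -/
theorem IsMonotoneConditional.increasingDifferences (hκ : IsMonotoneConditional μ A p ε κ)
    (hψ : Measurable ψ) {c : ℝ} (hc : ∀ x, |ψ x| ≤ c) (hsm : Supermodular ψ) :
    IncreasingDifferences (sliceAverage κ j ψ) := by
  intro s s' t t' hs ht
  have hm : ∀ t, Measurable fun x : N → ℝ => ψ (update x j t) := fun t =>
    hψ.comp measurable_update_left
  have hi : ∀ s t, Integrable (fun x : N → ℝ => ψ (update x j t)) (κ s) := fun s t =>
    (hm t).integrable_of_abs_le fun _ => hc _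
  have := hκ.mono (fun x => ψ (update x j t') - ψ (update x j t)) (c + c) ((hm t').sub (hm t))
    (fun x => (abs_sub _ _).trans (add_le_add (hc _) (hc _)))
    (fun x x' hx => hsm.update_le hx ht) hs
  simp only at this
  rw [integral_sub (hi _ _) (hi _ _), integral_sub (hi _ _) (hi _ _)] at this
  simp only [sliceAverage]
  linarith

variable [IsProbabilityMeasure μ]

/-- Conditioning stays at `p`: draw the subvector from `κ`, then coordinate `j` from `K` started at
coordinate `q`. The error is `ε` from `κ` plus `2 * ε` from replacing the conditional kernel by `K`.
-/
theorem IsMonotoneConditional.insert_node (hκ : IsMonotoneConditional μ A p ε κ) {q : N}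
    (hq : q ∈ A) (hj : p ≠ j) (hstep : MarkovStep μ A q j) {K : Kernel ℝ ℝ} [IsMarkovKernel K]
    (hK : MonotoneKernel K) {S : Set ℝ} (hS : MeasurableSet S)
    (hε : (μ.map fun x => x q).real Sᶜ ≤ ε)
    (hKS : ∀ s ∈ S, K s = (pairLaw μ q j).condKernel s) :
    ∃ κ' : Kernel ℝ (N → ℝ), IsMarkovKernel κ' ∧
      IsMonotoneConditional μ (insert j A) p (3 * ε) κ' := by
  have hqm : Measurable fun z : ℝ × (N → ℝ) => z.2 q := (measurable_pi_apply q).comp measurable_snd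
  set κ' := (κ ⊗ₖ K.comap (fun z : ℝ × (N → ℝ) => z.2 q) hqm).map
    (fun z : (N → ℝ) × ℝ => update z.1 j z.2) with hκ'
  have hu : Measurable fun z : (N → ℝ) × ℝ => update z.1 j z.2 := measurable_update'
  have : IsMarkovKernel κ' := Kernel.IsMarkovKernel.map _ hu
  have h_int : ∀ (φ : (N → ℝ) → ℝ) (c : ℝ), Measurable φ → (∀ x, |φ x| ≤ c) → ∀ s,
      ∫ x, φ x ∂κ' s = ∫ x, resample K q j φ x ∂κ s := by
    intro φ c hφ hc s
    rw [hκ', Kernel.map_apply _ hu, integral_map hu.aemeasurable hφ.aestronglyMeasurable,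
      ProbabilityTheory.integral_compProd]
    · rfl
    · exact (hφ.comp hu).integrable_of_abs_le fun _ => hc _
  refine ⟨κ', this, ?_, ?_, ?_⟩
  · intro s
    have hms : MeasurableSet {x : N → ℝ | x p = s} :=
      measurableSet_coord_eq p s
    rw [hκ', Kernel.map_apply _ hu, ae_map_iff hu.aemeasurable hms]
    simp only [update_of_ne hj]
    refine Kernel.ae_compProd_of_ae_ae (measurable_fst hms) ?_
    filter_upwards [hκ.ae_eq s] with x hx
    exact Filter.Eventually.of_forall fun _ => hx
  · intro φ c hφ hc hmono
    simp only [h_int φ c hφ hc]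
    exact hκ.mono _ c (measurable_resample hφ) (abs_resample_le hc) (hmono.resample hK hφ hc)
  · intro ψ hψ hc hdep
    simp only [h_int ψ 1 hψ hc]
    have h1 := hκ.approx _ (measurable_resample (K := K) hψ) (abs_resample_le hc) (hdep.resample hq)
    have h2 := _root_.abs_integral_resample_sub_le (j := j) hψ hc hS hε hKS
    rw [← hstep ψ 1 hψ hc hdep] at h2
    rw [abs_le] at h1 h2 ⊢
    constructor <;> linarith

/-- Conditioning moves to the new leaf: from the value `t` at `j`, draw coordinate `p` by the
backward kernel `K`, then the subvector from `κ`, and set coordinate `j` to `t`. The error is again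
`ε` plus `2 * ε`. -/
theorem IsMonotoneConditional.reverse (hκ : IsMonotoneConditional μ A p ε κ) (hp : p ∈ A)
    (hstep : MarkovStep μ A p j) {K : Kernel ℝ ℝ} [IsMarkovKernel K]
    (hK : MonotoneKernel K) {S : Set ℝ} (hS : MeasurableSet S)
    (hε : (μ.map fun x => x j).real Sᶜ ≤ ε)
    (hKS : ∀ s ∈ S, K s = (pairLaw μ j p).condKernel s) :
    ∃ κ' : Kernel ℝ (N → ℝ), IsMarkovKernel κ' ∧
      IsMonotoneConditional μ (insert j A) j (3 * ε) κ' := by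
  have hu : Measurable fun z : ℝ × (N → ℝ) => update z.2 j z.1 :=
    measurable_update'.comp (measurable_snd.prodMk measurable_fst)
  set κ' := (Kernel.id ×ₖ (κ ∘ₖ K)).map (fun z : ℝ × (N → ℝ) => update z.2 j z.1) with hκ'
  have : IsMarkovKernel κ' := Kernel.IsMarkovKernel.map _ hu
  have hκa : ∀ t, κ' t = ((κ ∘ₖ K) t).map fun x => update x j t := by
    intro t
    rw [hκ', Kernel.map_apply _ hu, Kernel.prod_apply, Kernel.id_apply, Measure.dirac_prod,
      Measure.map_map hu measurable_prodMk_left]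
    rfl
  have h_int : ∀ (φ : (N → ℝ) → ℝ) (c : ℝ), Measurable φ → (∀ x, |φ x| ≤ c) → ∀ t,
      ∫ x, φ x ∂κ' t = ∫ s, sliceAverage κ j φ (s, t) ∂K t := by
    intro φ c hφ hc t
    rw [hκa, integral_map measurable_update_left.aemeasurable hφ.aestronglyMeasurable,
      Kernel.integral_comp]
    · rfl
    · exact (hφ.comp measurable_update_left).integrable_of_abs_le fun _ => hc _
  refine ⟨κ', this, ?_, ?_, ?_⟩
  · intro t
    have hms : MeasurableSet {x : N → ℝ | x j = t} :=
      measurableSet_coord_eq j t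
    rw [hκa, ae_map_iff measurable_update_left.aemeasurable hms]
    simp
  · intro φ c hφ hc hmono t t' ht
    simp only [h_int φ c hφ hc]
    have hm : ∀ t, Measurable fun x : N → ℝ => φ (update x j t) := fun t =>
      hφ.comp measurable_update_left
    have hma : ∀ t, Measurable fun s => sliceAverage κ j φ (s, t) := fun t =>
      (measurable_sliceAverage hφ).comp measurable_prodMk_right
    calc ∫ s, sliceAverage κ j φ (s, t) ∂K t ≤ ∫ s, sliceAverage κ j φ (s, t') ∂K t := by
          refine integral_mono ((hma t).integrable_of_abs_le fun _ => abs_sliceAverage_le hc _)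
            ((hma t').integrable_of_abs_le fun _ => abs_sliceAverage_le hc _) fun s => ?_
          exact integral_mono ((hm t).integrable_of_abs_le fun _ => hc _)
            ((hm t').integrable_of_abs_le fun _ => hc _)
            fun x => hmono (update_mono_both le_rfl j ht)
      _ ≤ ∫ s, sliceAverage κ j φ (s, t') ∂K t' :=
          hK.integral_mono (hκ.mono _ c (hm t') (fun _ => hc _)
            fun x x' hx => hmono (update_mono_both hx j le_rfl)) (c := c)
            (fun s => abs_sliceAverage_le (κ := κ) (j := j) hc (s, t')) ht
  · intro ψ hψ hc hdep
    simp only [h_int ψ 1 hψ hc]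
    have h1 := hκ.abs_integral_resample_sub_le hp (K := (pairLaw μ p j).condKernel)
      hψ hc hdep
    rw [← hstep ψ 1 hψ hc hdep] at h1
    -- The edge law is disintegrated from both ends: from `p`, where the Markov step starts, and
    -- from `j`, where `κ'` starts.
    have h2 := integral_pairLaw μ p j (measurable_sliceAverage (κ := κ) (j := j) hψ)
      (abs_sliceAverage_le hc)
    have hsw : Measurable fun z : ℝ × ℝ => sliceAverage κ j ψ (z.2, z.1) :=
      (measurable_sliceAverage hψ).comp measurable_swap
    have h3 := integral_pairLaw μ j p hsw fun _ => abs_sliceAverage_le hc _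
    have h4 : ∫ z, sliceAverage κ j ψ z ∂pairLaw μ p j =
        ∫ z, sliceAverage κ j ψ (z.2, z.1) ∂pairLaw μ j p := by
      rw [← map_swap_pairLaw μ j p, integral_map measurable_swap.aemeasurable
        (measurable_sliceAverage hψ).aestronglyMeasurable]
      rfl
    have hmK : ∀ K : Kernel ℝ ℝ, IsMarkovKernel K →
        Measurable fun t => ∫ s, sliceAverage κ j ψ (s, t) ∂K t := fun K _ =>
      (hsw.stronglyMeasurable.integral_kernel_prod_right' (κ := K)).measurable
    have h5 := abs_integral_sub_le_of_eq_off (hmK K inferInstance)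
      (hmK (pairLaw μ j p).condKernel inferInstance) (c := 1)
      (fun t => abs_integral_le_of_forall_abs_le fun _ => abs_sliceAverage_le hc _)
      (fun t => abs_integral_le_of_forall_abs_le fun _ => abs_sliceAverage_le hc _) hS hε
      (fun t ht => by rw [hKS t ht])
    rw [← h2, h4, h3] at h1
    rw [abs_le] at h1 h5 ⊢
    constructor <;> linarith

end Tree

/-! ### Induction over finite rooted subtrees -/

section TreeComparison

variable {N : Type*} [DecidableEq N]

/-- Finite sets of nodes obtained from the root by successively adding children. -/
inductive IsRootedSubtree (E : N → N → Prop) (r : N) : Finset N → Prop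
  | root : IsRootedSubtree E r {r}
  | add {A : Finset N} {p j : N} : IsRootedSubtree E r A → p ∈ A → j ∉ A → E p j →
      IsRootedSubtree E r (insert j A)

/-- A law all of whose coordinates are attached to a rooted tree by Markov steps. -/
def IsMarkovAlong (E : N → N → Prop) (r : N) (μ : Measure (N → ℝ)) [IsProbabilityMeasure μ] :
    Prop :=
  ∀ ⦃A p j⦄, IsRootedSubtree E r A → p ∈ A → j ∉ A → E p j → MarkovStep μ A p j

variable {E : N → N → Prop} {r : N}

/-- Later leaves may hang from any node, so `q` is arbitrary. A new leaf either extends the vector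
forwards or becomes the conditioning node, which uses the backward kernel of its edge. -/
theorem IsMarkovAlong.exists_isMonotoneConditional {ν : Measure (N → ℝ)} [IsProbabilityMeasure ν]
    (hν : IsMarkovAlong E r ν) (hsi : ∀ p j, E p j → SetwiseIncreasing (pairLaw ν p j))
    (hsi' : ∀ p j, E p j → SetwiseIncreasing (pairLaw ν j p)) {A : Finset N}
    (hA : IsRootedSubtree E r A) :
    ∀ q ∈ A, ∀ ε : ℝ, 0 < ε → ∃ κ : Kernel ℝ (N → ℝ), IsMarkovKernel κ ∧
      IsMonotoneConditional ν A q ε κ := by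
  induction hA with
  | root =>
    intro q hq ε hε
    rw [Finset.mem_singleton.1 hq]
    exact ⟨_, inferInstance, isMonotoneConditional_singleton ν r hε.le⟩
  | @add A p j hA hp hj hpj ih =>
    intro q hq ε hε
    have hε3 : 0 < ε / 3 := by positivity
    have e3 : 3 * (ε / 3) = ε := by ring
    rcases Finset.mem_insert.1 hq with rfl | hqA
    · obtain ⟨κ, _, hκ⟩ := ih p hp _ hε3
      obtain ⟨K, _, hK, S, hS, hSε, hKS⟩ := (hsi' p q hpj).nearlyMonotone _ hε3
      rw [fst_pairLaw] at hSε
      obtain ⟨κ', h1, h2⟩ := hκ.reverse hp (hν hA hp hj hpj) hK hS hSε hKS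
      exact ⟨κ', h1, e3 ▸ h2⟩
    · obtain ⟨κ, _, hκ⟩ := ih q hqA _ hε3
      obtain ⟨K, _, hK, S, hS, hSε, hKS⟩ := (hsi p j hpj).nearlyMonotone _ hε3
      rw [fst_pairLaw] at hSε
      obtain ⟨κ', h1, h2⟩ := hκ.insert_node hp (by rintro rfl; exact hj hqA)
        (hν hA hp hj hpj) hK hS hSε hKS
      exact ⟨κ', h1, e3 ▸ h2⟩

/-- Comparison of two Markov laws along a rooted tree. The sign `θ` selects the direction. -/
theorem IsMarkovAlong.integral_le {μ ν : Measure (N → ℝ)} [IsProbabilityMeasure μ]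
    [IsProbabilityMeasure ν] (hμ : IsMarkovAlong E r μ) (hν : IsMarkovAlong E r ν)
    (hmarg : ∀ n, (μ.map fun x => x n) = ν.map fun x => x n)
    (hsiμ : ∀ p j, E p j → SetwiseIncreasing (pairLaw μ p j))
    (hsi : ∀ p j, E p j → SetwiseIncreasing (pairLaw ν p j))
    (hsi' : ∀ p j, E p j → SetwiseIncreasing (pairLaw ν j p)) {θ : ℝ} (hθ : |θ| ≤ 1)
    (hlo : ∀ p j, E p j → ∀ h : ℝ × ℝ → ℝ, Measurable h → (∀ z, |h z| ≤ 1) →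
      IncreasingDifferences h → θ * ∫ z, h z ∂pairLaw μ p j ≤ θ * ∫ z, h z ∂pairLaw ν p j)
    {A : Finset N} (hA : IsRootedSubtree E r A) :
    ∀ g : (N → ℝ) → ℝ, Measurable g → (∀ x, |g x| ≤ 1) → Supermodular g →
      DependsOn g (↑A : Set N) → θ * ∫ x, g x ∂μ ≤ θ * ∫ x, g x ∂ν := by
  induction hA with
  | root =>
    intro g hg _ _ hdep
    rw [dependsOn_singleton_integral hg hdep, dependsOn_singleton_integral hg hdep, hmarg]
  | @add A p j hA hp hj hpj ih =>
    intro g hg hc hsm hdep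
    refine le_of_forall_pos_le_add fun ε hε => ?_
    -- Two kernel replacements cost `2 * (ε / 6)` each, two passages to `κ` cost `ε / 6` each.
    have hε6 : 0 < ε / 6 := by positivity
    obtain ⟨K, _, hK, S, hS, hSε, hKS⟩ := (hsiμ p j hpj).nearlyMonotone _ hε6
    rw [fst_pairLaw] at hSε
    obtain ⟨κ, _, hκ⟩ := hν.exists_isMonotoneConditional hsi hsi' hA p hp _ hε6
    have hmul : ∀ a b δ : ℝ, |a - b| ≤ δ → |θ * a - θ * b| ≤ δ := fun a b δ h => by
      rw [← mul_sub, abs_mul]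
      exact (mul_le_of_le_one_left (abs_nonneg _) hθ).trans h
    have h1 := hmul _ _ _ (abs_integral_resample_sub_le (j := j) hg hc hS hSε hKS)
    rw [← hμ hA hp hj hpj g 1 hg hc hdep] at h1
    -- From `μ` to the hybrid: the law on `A` changes while the kernel of the last edge is kept.
    have h2 := ih (resample K p j g) (measurable_resample hg) (abs_resample_le hc)
      (hsm.resample hK hg hc) (hdep.resample hp)
    rw [hmarg] at hSε
    have h3 := hmul _ _ _ (abs_integral_resample_sub_le (j := j) hg hc hS hSε hKS)
    have h4 := hmul _ _ _ (hκ.abs_integral_resample_sub_le hp (K := (pairLaw μ p j).condKernel)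
      hg hc hdep)
    have h5 := hmul _ _ _ (hκ.abs_integral_resample_sub_le hp (K := (pairLaw ν p j).condKernel)
      hg hc hdep)
    rw [← hν hA hp hj hpj g 1 hg hc hdep] at h5
    have hm := measurable_sliceAverage (κ := κ) (j := j) hg
    -- From the hybrid to `ν`: only the law of the last edge changes.
    have h6 := hlo p j hpj _ hm (abs_sliceAverage_le hc) (hκ.increasingDifferences hg hc hsm)
    rw [integral_pairLaw μ p j hm (abs_sliceAverage_le hc),
      integral_pairLaw ν p j hm (abs_sliceAverage_le hc), hmarg] at h6
    rw [abs_le] at h1 h3 h4 h5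
    linarith [h1.1, h1.2, h3.1, h3.2, h4.1, h4.2, h5.1, h5.2]

theorem IsMarkovAlong.integral_le_of_bounded {μ ν : Measure (N → ℝ)} [IsProbabilityMeasure μ]
    [IsProbabilityMeasure ν] (hμ : IsMarkovAlong E r μ) (hν : IsMarkovAlong E r ν)
    (hmarg : ∀ n, (μ.map fun x => x n) = ν.map fun x => x n)
    (hsiμ : ∀ p j, E p j → SetwiseIncreasing (pairLaw μ p j))
    (hsi : ∀ p j, E p j → SetwiseIncreasing (pairLaw ν p j))
    (hsi' : ∀ p j, E p j → SetwiseIncreasing (pairLaw ν j p)) {A : Finset N}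
    (hA : IsRootedSubtree E r A) {g : (N → ℝ) → ℝ} (hg : Measurable g) {c : ℝ}
    (hc : ∀ x, |g x| ≤ c) (hsm : Supermodular g) (hdep : DependsOn g (↑A : Set N)) :
    ((∀ p j, E p j → OrthantLE (pairLaw μ p j) (pairLaw ν p j)) →
      ∫ x, g x ∂μ ≤ ∫ x, g x ∂ν) ∧
    ((∀ p j, E p j → OrthantLE (pairLaw ν p j) (pairLaw μ p j)) →
      ∫ x, g x ∂ν ≤ ∫ x, g x ∂μ) := by
  set d := max c 1 with hd
  have hd0 : 0 < d := lt_of_lt_of_le one_pos (le_max_right _ _)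
  have hc' : ∀ x, |d⁻¹ * g x| ≤ 1 := fun x => by
    rw [abs_mul, abs_of_pos (inv_pos.2 hd0), inv_mul_le_iff₀ hd0, mul_one]
    exact (hc x).trans (le_max_left _ _)
  have hsm' : Supermodular fun x => d⁻¹ * g x := fun x y => by
    have := mul_le_mul_of_nonneg_left (hsm x y) (inv_pos.2 hd0).le
    linarith
  have hdep' : DependsOn (fun x => d⁻¹ * g x) (↑A : Set N) := fun x y h => by
    simp only [hdep h]
  constructor
  · intro hlo
    have := hμ.integral_le hν hmarg hsiμ hsi hsi' (θ := 1) (by simp)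
      (fun p j hpj h hh hb hinc => by simpa using (hlo p j hpj).integral_le hh hb hinc) hA
      (fun x => d⁻¹ * g x) (hg.const_mul _) hc' hsm' hdep'
    rw [integral_const_mul, integral_const_mul, one_mul, one_mul] at this
    exact le_of_mul_le_mul_left this (inv_pos.2 hd0)
  · intro hlo
    have := hμ.integral_le hν hmarg hsiμ hsi hsi' (θ := -1) (by simp)
      (fun p j hpj h hh hb hinc => by simpa using (hlo p j hpj).integral_le hh hb hinc) hA
      (fun x => d⁻¹ * g x) (hg.const_mul _) hc' hsm' hdep'
    rw [integral_const_mul, integral_const_mul, neg_one_mul, neg_one_mul, neg_le_neg_iff] at this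
    exact le_of_mul_le_mul_left this (inv_pos.2 hd0)

end TreeComparison

/-! ### Directed trees -/

section DirectedTree

variable {N : Type*} {E : N → N → Prop} {r : N}

theorem IsDirectedWalk.concat {x a : N} {l : List N} (h : IsDirectedWalk E r x l) (hxa : E x a) :
    IsDirectedWalk E r a (l ++ [a]) := by
  obtain ⟨h1, h2, h3⟩ := h
  refine ⟨?_, ?_, by simp⟩
  · rw [List.isChain_append]
    refine ⟨h1, List.isChain_singleton a, ?_⟩
    intro y hy b hb
    rw [h3] at hy
    simp only [Option.mem_def, Option.some.injEq, List.head?_cons] at hy hb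
    rwa [← hy, ← hb]
  · rw [List.head?_append, h2]; rfl

/-- Appending `a` to the walks to `x` and `y` gives two walks to `a`; these coincide, and so do
their next-to-last nodes. -/
theorem IsDirectedTree.parent_unique (hT : IsDirectedTree E r) {x y a : N} (hx : E x a)
    (hy : E y a) : x = y := by
  obtain ⟨lx, hlx, -⟩ := hT x
  obtain ⟨ly, hly, -⟩ := hT y
  have h := (hT a).unique (hlx.concat hx) (hly.concat hy)
  have hl : lx = ly := List.append_cancel_right h
  have := hlx.2.2
  rw [hl, hly.2.2] at this
  exact (Option.some.inj this).symm

theorem IsDirectedTree.not_edge_root (hT : IsDirectedTree E r) (x : N) : ¬ E x r := by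
  intro hx
  obtain ⟨lx, hlx, -⟩ := hT x
  have h := (hT r).unique (hlx.concat hx) (⟨List.isChain_singleton r, rfl, rfl⟩ :
    IsDirectedWalk E r r [r])
  have hl : lx = [] := List.append_cancel_right (bs := [r]) (by simpa using h)
  have := hlx.2.1
  simp [hl] at this

theorem IsDirectedTree.reflTransGen (hT : IsDirectedTree E r) (i : N) :
    Relation.ReflTransGen E r i := by
  obtain ⟨l, ⟨h1, h2, h3⟩, -⟩ := hT i
  cases l with
  | nil => simp at h2
  | cons a l =>
    simp only [List.head?_cons, Option.some.injEq] at h2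
    subst h2
    refine List.relationReflTransGen_of_exists_isChain_cons l h1 ?_
    rw [List.getLast?_eq_some_getLast (by simp)] at h3
    exact Option.some.inj h3

variable [DecidableEq N]

theorem IsRootedSubtree.root_mem {A : Finset N} (hA : IsRootedSubtree E r A) : r ∈ A := by
  induction hA with
  | root => simp
  | add _ _ _ _ ih => exact Finset.mem_insert_of_mem ih

theorem IsRootedSubtree.parent_mem (hT : IsDirectedTree E r) {A : Finset N}
    (hA : IsRootedSubtree E r A) : ∀ {x a}, a ∈ A → E x a → x ∈ A := by
  induction hA with
  | root =>
    intro x a ha hxa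
    rw [Finset.mem_singleton.1 ha] at hxa
    exact absurd hxa (hT.not_edge_root x)
  | add _ hp _ hpj ih =>
    intro x a ha hxa
    rcases Finset.mem_insert.1 ha with rfl | ha
    · rw [hT.parent_unique hxa hpj]; exact Finset.mem_insert_of_mem hp
    · exact Finset.mem_insert_of_mem (ih ha hxa)

theorem IsRootedSubtree.ancestor_mem (hT : IsDirectedTree E r) {A : Finset N}
    (hA : IsRootedSubtree E r A) {x a : N} (ha : a ∈ A) (h : Relation.ReflTransGen E x a) :
    x ∈ A := by
  induction h using Relation.ReflTransGen.head_induction_on with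
  | refl => exact ha
  | head hxy _ ih => exact hA.parent_mem hT ih hxy

theorem IsRootedSubtree.exists_mem {A : Finset N} (hA : IsRootedSubtree E r A) {i : N}
    (h : Relation.ReflTransGen E r i) : ∃ A', IsRootedSubtree E r A' ∧ A ⊆ A' ∧ i ∈ A' := by
  induction h with
  | refl => exact ⟨A, hA, subset_rfl, hA.root_mem⟩
  | @tail b c _ hbc ih =>
    obtain ⟨A', hA', hsub, hb⟩ := ih
    by_cases hc : c ∈ A'
    · exact ⟨A', hA', hsub, hc⟩
    · exact ⟨_, hA'.add hb hc hbc, hsub.trans (Finset.subset_insert _ _), by simp⟩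

theorem IsDirectedTree.exists_isRootedSubtree (hT : IsDirectedTree E r) (S : Finset N) :
    ∃ A, IsRootedSubtree E r A ∧ S ⊆ A := by
  induction S using Finset.induction_on with
  | empty => exact ⟨_, .root, by simp⟩
  | insert i S _ ih =>
    obtain ⟨A, hA, hSA⟩ := ih
    obtain ⟨A', hA', hsub, hi⟩ := hA.exists_mem (hT.reflTransGen i)
    exact ⟨A', hA', Finset.insert_subset hi (hSA.trans hsub)⟩

/-- The parent of a new leaf separates the leaf from the rest of a rooted subtree. -/
theorem IsRootedSubtree.separates (hT : IsDirectedTree E r) {A : Finset N}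
    (hA : IsRootedSubtree E r A) {p j : N} (hp : p ∈ A) (hj : j ∉ A) (hpj : E p j) :
    Separates E p (A.erase p) {j} := by
  intro a ha b hb w _
  obtain rfl : j = b := (Finset.mem_singleton.1 hb).symm
  have haA := Finset.mem_of_mem_erase ha
  refine ⟨?_, (Finset.ne_of_mem_erase ha).symm, fun h => hj (h ▸ hp)⟩
  have haD : a ∈ {x | Relation.ReflTransGen E j x}ᶜ := fun h => hj (hA.ancestor_mem hT haA h)
  have hjD : j ∉ {x | Relation.ReflTransGen E j x}ᶜ := fun h => h Relation.ReflTransGen.refl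
  -- The walk must enter the set of descendants of `j`. As parents are unique, the only way in is
  -- the edge from `p` to `j`.
  obtain ⟨d, hd, hd1, hd2⟩ := w.exists_boundary_dart _ haD hjD
  have hd1' : ¬ Relation.ReflTransGen E j d.fst := hd1
  have hd2' : Relation.ReflTransGen E j d.snd := not_not.1 hd2
  have hfst : d.fst = p := by
    rcases ((SimpleGraph.fromRel_adj E _ _).1 d.adj).2 with h | h
    · rcases Relation.ReflTransGen.cases_tail hd2' with h' | ⟨c, hc, hcd⟩
      · rw [h'] at h
        exact hT.parent_unique h hpj
      · rw [hT.parent_unique hcd h] at hc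
        exact absurd hc hd1'
    · exact absurd (hd2'.tail h) hd1'
  rw [← hfst]
  exact w.dart_fst_mem_support_of_mem_darts hd

end DirectedTree

/-! ### Markov steps from conditional independence and from independence -/

section MarkovSteps

open Function

variable {N : Type*}

theorem map_infinitePi_eval (α : N → Measure ℝ) [∀ n, IsProbabilityMeasure (α n)] (n : N) :
    ((Measure.infinitePi α).map fun x => x n) = α n :=
  (measurePreserving_eval_infinitePi α n).map_eq

theorem indepFun_infinitePi_eval (α : N → Measure ℝ) [∀ n, IsProbabilityMeasure (α n)] :
    iIndepFun (fun n (x : N → ℝ) => x n) (Measure.infinitePi α) :=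
  iIndepFun_infinitePi (X := fun _ => id) (fun _ => measurable_id)

theorem pairLaw_infinitePi (α : N → Measure ℝ) [∀ n, IsProbabilityMeasure (α n)] {i j : N}
    (hij : i ≠ j) : pairLaw (Measure.infinitePi α) i j = (α i).prod (α j) := by
  have h := ((indepFun_infinitePi_eval α).indepFun hij)
  rw [indepFun_iff_map_prod_eq_prod_map_map (measurable_pi_apply i).aemeasurable
    (measurable_pi_apply j).aemeasurable] at h
  rw [pairLaw, h, map_infinitePi_eval, map_infinitePi_eval]

variable [DecidableEq N]

theorem integral_eq_integral_resample {β : Type*} [MeasurableSpace β] {μ : Measure (N → ℝ)}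
    [IsProbabilityMeasure μ] {A : Finset N} {p j : N} {K : Kernel ℝ ℝ} {W : (N → ℝ) → β}
    (hW : Measurable W) {a : β × ℝ → N → ℝ} (ha : Measurable a)
    (haW : ∀ x y, ∀ i ∈ insert j A, a (W x, y) i = update x j y i) {η : Kernel β ℝ}
    [IsMarkovKernel η] (hη : ∀ x, η (W x) = K (x p))
    (hlaw : μ.map (fun x => (W x, x j)) = μ.map W ⊗ₘ η) {g : (N → ℝ) → ℝ} (hg : Measurable g)
    {c : ℝ} (hc : ∀ x, |g x| ≤ c) (hdep : DependsOn g (↑(insert j A) : Set N)) :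
    ∫ x, g x ∂μ = ∫ x, resample K p j g x ∂μ := by
  have hga : Measurable fun z => g (a z) := hg.comp ha
  have hWm : IsProbabilityMeasure (μ.map W) := Measure.isProbabilityMeasure_map hW.aemeasurable
  have hpair : Measurable fun x : N → ℝ => (W x, x j) := hW.prodMk (measurable_pi_apply j)
  have hupd : ∀ x y, g (a (W x, y)) = g (update x j y) := fun x y => hdep fun i hi => haW x y i hi
  calc ∫ x, g x ∂μ = ∫ x, g (a (W x, x j)) ∂μ := by
        simp only [hupd, update_eq_self]
    _ = ∫ z, g (a z) ∂μ.map fun x => (W x, x j) :=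
        (integral_map hpair.aemeasurable hga.aestronglyMeasurable).symm
    _ = ∫ w, ∫ y, g (a (w, y)) ∂η w ∂μ.map W := by
        rw [hlaw, Measure.integral_compProd (hga.integrable_of_abs_le fun _ => hc _)]
    _ = ∫ x, ∫ y, g (a (W x, y)) ∂η (W x) ∂μ :=
        integral_map hW.aemeasurable
          (hga.stronglyMeasurable.integral_kernel_prod_right' (κ := η)).aestronglyMeasurable
    _ = ∫ x, resample K p j g x ∂μ := by
        simp only [hupd, hη, resample]

/-- Split the coordinates in `A` into the coordinate `p` and the remaining ones. -/
def splitAt (A : Finset N) (p : N) (x : N → ℝ) : ℝ × (↥(A.erase p) → ℝ) :=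
  (x p, fun a => x a)

/-- Reassemble a vector from `splitAt` and the coordinate `j`. -/
def assemble (A : Finset N) (p j : N) (z : (ℝ × (↥(A.erase p) → ℝ)) × ℝ) (n : N) : ℝ :=
  -- Nodes outside `insert j A` also receive the value at `p`; this is harmless, since `g` does not
  -- see them.
  if n = j then z.2 else if h : n ∈ A.erase p then z.1.2 ⟨n, h⟩ else z.1.1

theorem measurable_splitAt (A : Finset N) (p : N) : Measurable (splitAt A p) :=
  (measurable_pi_apply p).prodMk (measurable_pi_lambda _ fun _ => measurable_pi_apply _)

theorem measurable_assemble (A : Finset N) (p j : N) : Measurable (assemble A p j) := by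
  refine measurable_pi_lambda _ fun n => ?_
  unfold assemble
  split_ifs <;> fun_prop

theorem assemble_splitAt (A : Finset N) (p j : N) (x : N → ℝ) (y : ℝ) :
    ∀ i ∈ insert j A, assemble A p j (splitAt A p x, y) i = update x j y i := by
  intro i hi
  by_cases hij : i = j
  · subst hij; simp [assemble]
  · have hiA : i ∈ A := by simpa [hij] using hi
    by_cases hip : i = p
    · subst hip; simp [assemble, splitAt, hij]
    · simp [assemble, splitAt, hij, hip, hiA]

theorem HasMarkovTreeDependence.isMarkovAlong [Countable N] {E : N → N → Prop} {r : N}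
    (hT : IsDirectedTree E r) {μ : Measure (N → ℝ)} [IsProbabilityMeasure μ]
    (hμ : HasMarkovTreeDependence E μ) : IsMarkovAlong E r μ := by
  intro A p j hA hp hj hpj g c hg hc hdep
  have hpm : Measurable fun x : N → ℝ => x p := measurable_pi_apply p
  have hjm : Measurable fun x : N → ℝ => x j := measurable_pi_apply j
  have hci := hμ (A.erase p) {j} p
    (Finset.disjoint_singleton_right.2 fun h => hj (Finset.mem_of_mem_erase h))
    (hA.separates hT hp hj hpj)
  have hci' := hci.comp measurable_id
    (measurable_pi_apply (⟨j, Finset.mem_singleton_self j⟩ : ({j} : Finset N)))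
  have hgm : Measurable fun (x : N → ℝ) (a : ↥(A.erase p)) => x a :=
    measurable_pi_lambda _ fun a => measurable_pi_apply _
  -- Conditional independence in kernel form: given all coordinates in `A`, the law of coordinate
  -- `j` depends on coordinate `p` alone.
  have hcd := (condIndepFun_iff_condDistrib_prod_ae_eq_prodMkRight (μ := μ) hjm hgm hpm).1 hci'
  have hlaw : (μ.map (splitAt A p)) ⊗ₘ condDistrib (fun x : N → ℝ => x j) (splitAt A p) μ =
      μ.map fun x => (splitAt A p x, x j) := compProd_map_condDistrib hjm.aemeasurable
  replace hlaw := (Measure.compProd_congr hcd).symm.trans hlaw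
  have hK : condDistrib (fun x : N → ℝ => x j) (fun x => x p) μ = (pairLaw μ p j).condKernel := by
    rw [condDistrib]; rfl
  rw [← hK]
  exact integral_eq_integral_resample (measurable_splitAt A p) (measurable_assemble A p j)
    (assemble_splitAt A p j)
    (η := (condDistrib (fun x : N → ℝ => x j) (fun x => x p) μ).prodMkRight _)
    (fun x => rfl) hlaw.symm hg hc hdep

theorem isMarkovAlong_infinitePi (E : N → N → Prop) (r : N) (α : N → Measure ℝ)
    [∀ n, IsProbabilityMeasure (α n)] : IsMarkovAlong E r (Measure.infinitePi α) := by
  intro A p j _ hp hj _ g c hg hc hdep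
  have hpj : p ≠ j := fun h => hj (h ▸ hp)
  have hjm : Measurable fun x : N → ℝ => x j := measurable_pi_apply j
  have hind := (indepFun_infinitePi_eval α).indepFun_finset A {j}
    (Finset.disjoint_singleton_right.2 hj) fun n => measurable_pi_apply n
  have hm1 : Measurable fun w : A → ℝ => (w ⟨p, hp⟩, fun a : ↥(A.erase p) =>
      w ⟨a, Finset.mem_of_mem_erase a.2⟩) :=
    (measurable_pi_apply _).prodMk (measurable_pi_lambda _ fun a => measurable_pi_apply _)
  have hind' : IndepFun (splitAt A p) (fun x : N → ℝ => x j) (Measure.infinitePi α) :=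
    hind.comp hm1 (measurable_pi_apply (⟨j, Finset.mem_singleton_self j⟩ : ({j} : Finset N)))
  rw [indepFun_iff_map_prod_eq_prod_map_map (measurable_splitAt A p).aemeasurable
    hjm.aemeasurable, map_infinitePi_eval] at hind'
  have hlaw : (Measure.infinitePi α).map (fun x => (splitAt A p x, x j)) =
      (Measure.infinitePi α).map (splitAt A p) ⊗ₘ Kernel.const _ (α j) := by
    have := Measure.isProbabilityMeasure_map (μ := Measure.infinitePi α)
      (measurable_splitAt A p).aemeasurable
    rw [Measure.compProd_const, hind']
  have h := integral_eq_integral_resample (p := p) (K := Kernel.const ℝ (α j))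
    (measurable_splitAt A p) (measurable_assemble A p j) (assemble_splitAt A p j)
    (η := Kernel.const _ (α j)) (fun x => rfl) hlaw hg hc hdep
  rw [h]
  -- `MarkovStep` uses a fixed version of the conditional kernel, which is known to be constant only
  -- almost everywhere.
  have hK : ∀ᵐ s ∂(Measure.infinitePi α).map fun x => x p,
      Kernel.const ℝ (α j) s = (pairLaw (Measure.infinitePi α) p j).condKernel s := by
    rw [← fst_pairLaw _ p j]
    refine eq_condKernel_of_measure_eq_compProd _ ?_
    rw [fst_pairLaw, map_infinitePi_eval, Measure.compProd_const, pairLaw_infinitePi α hpj]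
  refine integral_congr_ae ?_
  filter_upwards [ae_of_ae_map (measurable_pi_apply p).aemeasurable hK] with x hx
  simp only [resample, hx]

end MarkovSteps

/-! ### Reduction of the supermodular order to bounded functions -/

section Truncation

open Filter Topology

/-- By integrability, `n + 1` times the mass of `{n < φ}` is at most a vanishing tail integral of `φ
+ 1`; the rest of the complement contributes at most `1 / (n + 1)`. -/
theorem tendsto_mul_measureReal_compl {α : Measure ℝ} [IsProbabilityMeasure α] {φ : ℝ → ℝ}
    (hφm : Measurable φ) (hφ : Integrable φ α) {K : ℕ → Set ℝ}
    (hK : ∀ n : ℕ, α ({t | φ t ≤ n} \ K n) < ENNReal.ofReal (1 / ((n : ℝ) + 1) ^ 2)) :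
    Tendsto (fun n : ℕ => ((n : ℝ) + 1) * α.real (K n)ᶜ) atTop (𝓝 0) := by
  have hSm : ∀ n : ℕ, MeasurableSet {t | (n : ℝ) < φ t} := fun n =>
    measurableSet_lt measurable_const hφm
  have hanti : Antitone fun n : ℕ => {t | (n : ℝ) < φ t} := fun m n hmn t ht => by
    simp only [mem_ofPred_eq] at ht ⊢
    exact lt_of_le_of_lt (by exact_mod_cast hmn) ht
  have h_int : Integrable (fun t => φ t + 1) α := hφ.add (integrable_const 1)
  have hempty : ⋂ n : ℕ, {t | (n : ℝ) < φ t} = ∅ := by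
    refine eq_empty_of_forall_notMem fun t ht => ?_
    obtain ⟨n, hn⟩ := exists_nat_ge (φ t)
    have := mem_iInter.1 ht n
    simp only [mem_ofPred_eq] at this
    linarith
  have h1 := tendsto_setIntegral_of_antitone (f := fun t => φ t + 1) hSm hanti
    ⟨0, h_int.integrableOn⟩
  rw [hempty, setIntegral_empty] at h1
  have h2 := h1.add (tendsto_one_div_add_atTop_nhds_zero_nat (𝕜 := ℝ))
  rw [add_zero] at h2
  refine squeeze_zero (fun n => by positivity) (fun n => ?_) h2
  have hn : (0 : ℝ) < (n : ℝ) + 1 := by positivity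
  have hle : α.real (K n)ᶜ ≤ α.real {t | (n : ℝ) < φ t} + 1 / ((n : ℝ) + 1) ^ 2 := by
    have hsub : (K n)ᶜ ⊆ {t | (n : ℝ) < φ t} ∪ {t | φ t ≤ n} \ K n := fun t ht => by
      by_cases h : φ t ≤ n
      · exact Or.inr ⟨h, ht⟩
      · exact Or.inl (not_le.1 h)
    refine (measureReal_mono hsub).trans ((measureReal_union_le _ _).trans ?_)
    gcongr
    exact ENNReal.toReal_le_of_le_ofReal (by positivity) (hK n).le
  have hmul : ((n : ℝ) + 1) * α.real {t | (n : ℝ) < φ t} ≤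
      ∫ t in {t | (n : ℝ) < φ t}, (φ t + 1) ∂α := by
    have := setIntegral_mono_on (μ := α) (f := fun _ => (n : ℝ) + 1) (g := fun t => φ t + 1)
      (integrable_const _).integrableOn h_int.integrableOn (hSm n) fun t ht => by
        simp only [mem_ofPred_eq] at ht
        linarith
    rwa [setIntegral_const, smul_eq_mul, mul_comm] at this
  calc ((n : ℝ) + 1) * α.real (K n)ᶜ
      ≤ ((n : ℝ) + 1) * (α.real {t | (n : ℝ) < φ t} + 1 / ((n : ℝ) + 1) ^ 2) := by gcongr
    _ = ((n : ℝ) + 1) * α.real {t | (n : ℝ) < φ t} + 1 / ((n : ℝ) + 1) := by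
        field_simp
    _ ≤ _ := by gcongr

variable {ι : Type*} [Fintype ι]

theorem one_le_weight {φ : ι → ℝ → ℝ} (hφ0 : ∀ i t, 0 ≤ φ i t) (x : ι → ℝ) : 1 ≤ weight φ x :=
  le_add_of_nonneg_right (Finset.sum_nonneg fun i _ => hφ0 i _)

/-- The integrands differ only where some coordinate leaves `K i n`. There `f` is dominated by the
weight, whose integral over sets of vanishing measure tends to 0, and the retracted function is `O(n
+ 1)`, which `hK` absorbs. -/
theorem tendsto_integral_retraction {ρ : Measure (ι → ℝ)} [IsProbabilityMeasure ρ]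
    {φ : ι → ℝ → ℝ} (hφ0 : ∀ i t, 0 ≤ φ i t)
    (hw : Integrable (weight φ) ρ) {f : (ι → ℝ) → ℝ} (hf : Measurable f) {c : ℝ}
    (hc : ∀ x, |f x| ≤ c * weight φ x) {K : ι → ℕ → Set ℝ} (hKm : ∀ i n, MeasurableSet (K i n))
    (hK : ∀ i, Tendsto (fun n : ℕ => ((n : ℝ) + 1) * (ρ.map fun x => x i).real (K i n)ᶜ) atTop
      (𝓝 0))
    {π : ι → ℕ → ℝ → ℝ} (hπm : ∀ i n, Measurable (π i n)) {d : ι → ℝ}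
    (hπφ : ∀ i n t, φ i (π i n t) ≤ n + d i) (hπ : ∀ i n, ∀ t ∈ K i n, π i n t = t) :
    Tendsto (fun n => ∫ x, f (fun i => π i n (x i)) ∂ρ) atTop (𝓝 (∫ x, f x ∂ρ)) := by
  have hc0 : 0 ≤ c := by
    by_contra hneg
    have h1 := hc fun _ => 0
    have h2 := one_le_weight hφ0 fun _ => (0 : ℝ)
    nlinarith [abs_nonneg (f fun _ => 0)]
  set D := ∑ i, |d i| with hD
  have hD0 : 0 ≤ D := Finset.sum_nonneg fun i _ => abs_nonneg _
  set m : ℝ := (Fintype.card ι : ℝ) with hm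
  have hm0 : 0 ≤ m := by positivity
  set B : ℕ → Set (ι → ℝ) := fun n => ⋃ i, (fun x : ι → ℝ => x i) ⁻¹' (K i n)ᶜ with hB
  have hBm : ∀ n, MeasurableSet (B n) := fun n =>
    MeasurableSet.iUnion fun i => measurable_pi_apply i (hKm i n).compl
  have hBr : ∀ n, ρ.real (B n) ≤ ∑ i, (ρ.map fun x => x i).real (K i n)ᶜ := fun n => by
    refine (measureReal_iUnion_fintype_le _).trans (Finset.sum_le_sum fun i _ => le_of_eq ?_)
    rw [map_measureReal_apply (measurable_pi_apply i) (hKm i n).compl]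
  have hsum : Tendsto (fun n : ℕ => ((n : ℝ) + 1) * ρ.real (B n)) atTop (𝓝 0) := by
    have h := tendsto_finsetSum Finset.univ fun i _ => hK i
    simp only [Finset.sum_const_zero] at h
    refine squeeze_zero (fun n => by positivity) (fun n => ?_) h
    rw [← Finset.mul_sum]
    exact mul_le_mul_of_nonneg_left (hBr n) (by positivity)
  have hB0 : Tendsto (fun n => ρ (B n)) atTop (𝓝 0) := by
    have h : Tendsto (fun n => ρ.real (B n)) atTop (𝓝 0) := by
      refine squeeze_zero (fun n => measureReal_nonneg) (fun n => ?_) hsum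
      exact le_mul_of_one_le_left measureReal_nonneg (by
        have : (0 : ℝ) ≤ n := n.cast_nonneg
        linarith)
    have := ENNReal.tendsto_ofReal h
    simpa [ofReal_measureReal] using this
  have hbound : ∀ n (x : ι → ℝ), weight φ (fun i => π i n (x i)) ≤ (1 + m + D) * ((n : ℝ) + 1) := by
    intro n x
    have hn : (0 : ℝ) ≤ n := n.cast_nonneg
    have h1 : ∑ i, φ i (π i n (x i)) ≤ ∑ i, ((n : ℝ) + |d i|) :=
      Finset.sum_le_sum fun i _ => (hπφ i n _).trans (by gcongr; exact le_abs_self _)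
    rw [Finset.sum_add_distrib, Finset.sum_const, nsmul_eq_mul, Finset.card_univ, ← hm, ← hD] at h1
    simp only [weight]
    nlinarith [mul_nonneg hD0 hn, mul_nonneg hm0 hn]
  have hfn : ∀ n, Measurable fun x : ι → ℝ => f fun i => π i n (x i) := fun n =>
    hf.comp (measurable_pi_lambda _ fun i => (hπm i n).comp (measurable_pi_apply i))
  have hfnb : ∀ n (x : ι → ℝ), |f fun i => π i n (x i)| ≤ c * ((1 + m + D) * ((n : ℝ) + 1)) :=
    fun n x => (hc _).trans (mul_le_mul_of_nonneg_left (hbound n x) hc0)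
  have hfi : Integrable f ρ :=
    (hw.const_mul c).mono' hf.aestronglyMeasurable (Eventually.of_forall hc)
  rw [tendsto_iff_norm_sub_tendsto_zero]
  have hlim : Tendsto (fun n : ℕ => c * ∫ x in B n, weight φ x ∂ρ +
      c * (1 + m + D) * (((n : ℝ) + 1) * ρ.real (B n))) atTop (𝓝 0) := by
    have h1 := (hw.tendsto_setIntegral_nhds_zero hB0).const_mul c
    have h2 := hsum.const_mul (c * (1 + m + D))
    simpa using h1.add h2
  refine squeeze_zero (fun n => norm_nonneg _) (fun n => ?_) hlim
  have hfni : Integrable (fun x : ι → ℝ => f fun i => π i n (x i)) ρ :=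
    (hfn n).integrable_of_abs_le (hfnb n)
  rw [← integral_sub hfni hfi]
  set C := c * ((1 + m + D) * ((n : ℝ) + 1)) with hC
  calc ‖∫ x, ((f fun i => π i n (x i)) - f x) ∂ρ‖
      ≤ ∫ x, ‖(f fun i => π i n (x i)) - f x‖ ∂ρ := norm_integral_le_integral_norm _
    _ ≤ ∫ x, (B n).indicator (fun x => c * weight φ x + C) x ∂ρ := by
        refine integral_mono (hfni.sub hfi).norm
          (((hw.const_mul c).add (integrable_const C)).indicator (hBm n)) fun x => ?_
        by_cases hx : x ∈ B n
        · rw [indicator_of_mem hx]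
          refine (norm_sub_le _ _).trans ?_
          have h1 := hfnb n x
          have h2 := hc x
          simp only [Real.norm_eq_abs]
          linarith
        · rw [indicator_of_notMem hx]
          have : (fun i => π i n (x i)) = x := by
            ext i
            refine hπ i n _ ?_
            by_contra hi
            exact hx (mem_iUnion.2 ⟨i, hi⟩)
          simp [this]
    _ = c * ∫ x in B n, weight φ x ∂ρ + c * (1 + m + D) * (((n : ℝ) + 1) * ρ.real (B n)) := by
        rw [integral_indicator (hBm n), integral_add (hw.const_mul c).integrableOn
          (integrable_const C).integrableOn, integral_const_mul, setIntegral_const, smul_eq_mul, hC]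
        ring

/-- For laws with equal marginals, the supermodular order is determined by bounded functions. -/
theorem supermodularLE_of_bounded {ρ ρ' : Measure (ι → ℝ)} [IsProbabilityMeasure ρ]
    [IsProbabilityMeasure ρ'] (hmarg : ∀ i, (ρ.map fun x => x i) = ρ'.map fun x => x i)
    (h : ∀ (f : (ι → ℝ) → ℝ) (c : ℝ), Measurable f → (∀ x, |f x| ≤ c) → Supermodular f →
      ∫ x, f x ∂ρ ≤ ∫ x, f x ∂ρ') : SupermodularLE ρ ρ' := by
  intro φ hφm hφ0 hw hw' f hf hsm ⟨c, hc⟩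
  have hprob : ∀ i, IsProbabilityMeasure (ρ.map fun x => x i) := fun i =>
    Measure.isProbabilityMeasure_map (measurable_pi_apply i).aemeasurable
  have hφi : ∀ i, Integrable (φ i) (ρ.map fun x => x i) := fun i => by
    rw [integrable_map_measure (hφm i).aestronglyMeasurable (measurable_pi_apply i).aemeasurable]
    refine hw.mono' ((hφm i).comp (measurable_pi_apply i)).aestronglyMeasurable
      (Eventually.of_forall fun x => ?_)
    rw [Function.comp_apply, Real.norm_of_nonneg (hφ0 i _)]
    have := Finset.single_le_sum (f := fun i => φ i (x i)) (fun i _ => hφ0 i _) (Finset.mem_univ i)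
    simp only [weight]
    linarith
  have hex : ∀ i (n : ℕ), ∃ K, K ⊆ {t | φ i t ≤ n} ∧ IsCompact K ∧
      (ρ.map fun x => x i) ({t | φ i t ≤ n} \ K) < ENNReal.ofReal (1 / ((n : ℝ) + 1) ^ 2) :=
    fun i n => (measurableSet_le (hφm i) measurable_const).exists_isCompact_sdiff_lt
      (measure_ne_top _ _) (ENNReal.ofReal_pos.2 (by positivity)).ne'
  choose K hKsub hKc hKlt using hex
  -- Inserting 0 ensures a nonempty target, at the price of the constant `φ i 0` in the bound.
  have hret : ∀ i n, ∃ π : ℝ → ℝ, Monotone π ∧ (∀ t, π t ∈ insert 0 (K i n)) ∧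
      ∀ t ∈ insert 0 (K i n), π t = t := fun i n =>
    ((hKc i n).insert 0).exists_monotone_retraction ⟨0, mem_insert _ _⟩
  choose π hπmono hπmem hπid using hret
  have hπφ : ∀ i n t, φ i (π i n t) ≤ n + φ i 0 := fun i n t => by
    rcases hπmem i n t with h0 | h0
    · rw [h0]; exact le_add_of_nonneg_left n.cast_nonneg
    · have : φ i (π i n t) ≤ n := hKsub i n h0
      linarith [hφ0 i 0]
  have hKt := fun i => tendsto_mul_measureReal_compl (hφm i) (hφi i) (hKlt i)
  have t1 := tendsto_integral_retraction hφ0 hw hf hc (fun i n => (hKc i n).measurableSet) hKt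
    (fun i n => (hπmono i n).measurable) hπφ fun i n t ht => hπid i n t (mem_insert_of_mem _ ht)
  simp only [hmarg] at hKt
  have t2 := tendsto_integral_retraction hφ0 hw' hf hc (fun i n => (hKc i n).measurableSet) hKt
    (fun i n => (hπmono i n).measurable) hπφ fun i n t ht => hπid i n t (mem_insert_of_mem _ ht)
  have hc0 : 0 ≤ c := by
    by_contra hneg
    have h1 := hc fun _ => 0
    have h2 := one_le_weight hφ0 fun _ => (0 : ℝ)
    nlinarith [abs_nonneg (f fun _ => 0)]
  refine le_of_tendsto_of_tendsto' t1 t2 fun n => h _ (c * (1 + ∑ i, ((n : ℝ) + φ i 0))) ?_ ?_ ?_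
  · exact hf.comp (measurable_pi_lambda _ fun i =>
      (hπmono i n).measurable.comp (measurable_pi_apply i))
  · intro x
    refine (hc _).trans (mul_le_mul_of_nonneg_left ?_ hc0)
    simp only [weight]
    gcongr with i
    exact hπφ i n _
  · intro x y
    -- Increasing coordinate maps commute with minimum and maximum, so truncating the arguments
    -- preserves supermodularity.
    have := hsm (fun i => π i n (x i)) fun i => π i n (y i)
    have e1 : ((fun i => π i n (x i)) ⊓ fun i => π i n (y i)) = fun i => π i n ((x ⊓ y) i) := by
      ext i; exact ((hπmono i n).map_inf _ _).symm
    have e2 : ((fun i => π i n (x i)) ⊔ fun i => π i n (y i)) = fun i => π i n ((x ⊔ y) i) := by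
      ext i; exact ((hπmono i n).map_sup _ _).symm
    rwa [e1, e2] at this

end Truncation

/-! ### Markov tree distributions -/

section MarkovTree

variable {N : Type*} {F : N → ℝ → I} {E : N → N → Prop} {B C : ∀ i j, E i j → Copula}
  {μ ν : Measure (N → ℝ)}

theorem pairLaw_real_prod_Iic (μ : Measure (N → ℝ)) (i j : N) (s t : ℝ) :
    (pairLaw μ i j).real (Iic s ×ˢ Iic t) = μ.real {x | x i ≤ s ∧ x j ≤ t} := by
  rw [pairLaw, map_measureReal_apply (measurable_pair i j)
    (measurableSet_Iic.prod measurableSet_Iic)]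
  congr 1

theorem Realizes.map_real_Iic (h : Realizes F E B μ) (n : N) (t : ℝ) :
    (μ.map fun x => x n).real (Iic t) = F n t := by
  rw [map_measureReal_apply (measurable_pi_apply n) measurableSet_Iic, ← h.1]
  congr 1

theorem Realizes.pairLaw_real (h : Realizes F E B μ) {i j : N} (hij : E i j) (s t : ℝ) :
    (pairLaw μ i j).real (Iic s ×ˢ Iic t) = (B i j hij).toFun (F i s) (F j t) := by
  rw [pairLaw_real_prod_Iic, h.2 i j hij]

theorem Realizes.setwiseIncreasing [IsProbabilityMeasure μ] (h : Realizes F E B μ) {i j : N}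
    (hij : E i j) (hsi : (B i j hij).IsSI) : SetwiseIncreasing (pairLaw μ i j) := by
  obtain ⟨γ, _, hdf, hγ⟩ := hsi
  obtain ⟨h1, h2⟩ := Copula.uniform_of_hasDF _ hdf
  refine hγ.setwiseIncreasing.of_copula h1 h2 fun s t => ?_
  rw [fst_pairLaw, snd_pairLaw, h.map_real_Iic, h.map_real_Iic, h.pairLaw_real hij, hdf]

theorem Realizes.setwiseIncreasing_swap [IsProbabilityMeasure μ] (h : Realizes F E B μ) {i j : N}
    (hij : E i j) (hci : (B i j hij).IsCI) : SetwiseIncreasing (pairLaw μ j i) := by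
  obtain ⟨γ, _, hdf, -, hγ⟩ := hci
  obtain ⟨h1, h2⟩ := Copula.uniform_of_hasDF _ hdf
  have : IsProbabilityMeasure (γ.map Prod.swap) :=
    Measure.isProbabilityMeasure_map measurable_swap.aemeasurable
  have hswap : ∀ (γ : Measure (ℝ × ℝ)) (s t : ℝ),
      (γ.map Prod.swap).real (Iic s ×ˢ Iic t) = γ.real (Iic t ×ˢ Iic s) := fun γ s t => by
    rw [map_measureReal_apply measurable_swap (measurableSet_Iic.prod measurableSet_Iic),
      preimage_swap_prod]
  refine hγ.setwiseIncreasing.of_copula (by rwa [Measure.fst_map_swap])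
    (by rwa [Measure.snd_map_swap]) fun s t => ?_
  rw [fst_pairLaw, snd_pairLaw, h.map_real_Iic, h.map_real_Iic, ← map_swap_pairLaw, hswap, hswap,
    h.pairLaw_real hij, hdf]

theorem Copula.IsCI.isSI {D : Copula} (h : D.IsCI) : D.IsSI := by
  obtain ⟨γ, hγ, h1, h2, -⟩ := h
  exact ⟨γ, hγ, h1, h2⟩

theorem Realizes.map_eq [IsProbabilityMeasure μ] [IsProbabilityMeasure ν] (hμ : Realizes F E B μ)
    (hν : Realizes F E C ν) (n : N) : (μ.map fun x => x n) = ν.map fun x => x n := by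
  refine Measure.ext_of_Iic _ _ fun t => (measureReal_eq_measureReal_iff).1 ?_
  rw [hμ.map_real_Iic, hν.map_real_Iic]

theorem Realizes.orthantLE [IsProbabilityMeasure μ] [IsProbabilityMeasure ν]
    (hμ : Realizes F E B μ) (hν : Realizes F E C ν) {i j : N} (hij : E i j)
    (h : (B i j hij).LoLE (C i j hij)) : OrthantLE (pairLaw μ i j) (pairLaw ν i j) where
  fst_eq := by rw [fst_pairLaw, fst_pairLaw, hμ.map_eq hν]
  snd_eq := by rw [snd_pairLaw, snd_pairLaw, hμ.map_eq hν]
  le s t := by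
    refine (ENNReal.toReal_le_toReal (measure_ne_top _ _) (measure_ne_top _ _)).1 ?_
    change (pairLaw μ i j).real _ ≤ (pairLaw ν i j).real _
    rw [hμ.pairLaw_real hij, hν.pairLaw_real hij]
    exact h _ _

/-- Finitely many nodes lie in one rooted subtree, and pulling back along `k` preserves
supermodularity even if `k` repeats nodes. -/
theorem processSupermodularLE_of_bounded [DecidableEq N] {r : N} (hT : IsDirectedTree E r)
    [IsProbabilityMeasure μ] [IsProbabilityMeasure ν]
    (hmarg : ∀ n, (μ.map fun x => x n) = ν.map fun x => x n)
    (h : ∀ A, IsRootedSubtree E r A → ∀ (g : (N → ℝ) → ℝ) (c : ℝ), Measurable g →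
      (∀ x, |g x| ≤ c) → Supermodular g → DependsOn g (↑A : Set N) →
      ∫ x, g x ∂μ ≤ ∫ x, g x ∂ν) : ProcessSupermodularLE μ ν := by
  intro m k
  have hk : Measurable fun (x : N → ℝ) (i : Fin m) => x (k i) :=
    measurable_pi_lambda _ fun i => measurable_pi_apply _
  have := Measure.isProbabilityMeasure_map (μ := μ) hk.aemeasurable
  have := Measure.isProbabilityMeasure_map (μ := ν) hk.aemeasurable
  refine supermodularLE_of_bounded (fun i => ?_) fun f c hf hc hsm => ?_
  · rw [Measure.map_map (measurable_pi_apply i) hk, Measure.map_map (measurable_pi_apply i) hk]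
    exact hmarg (k i)
  · obtain ⟨A, hA, hkA⟩ := hT.exists_isRootedSubtree (Finset.univ.image k)
    rw [integral_map hk.aemeasurable hf.aestronglyMeasurable,
      integral_map hk.aemeasurable hf.aestronglyMeasurable]
    refine h A hA _ c (hf.comp hk) (fun x => hc _) (fun x y => hsm _ _) fun x y hxy => ?_
    congr 1
    ext i
    exact hxy _ (hkA (Finset.mem_image_of_mem k (Finset.mem_univ i)))

/-- The product of the marginals takes the place of the CI law: it is Markov along the tree, and its
edge laws are stochastically increasing both ways. -/
theorem psmd_of_realizes [Countable N] {r : N} (hT : IsDirectedTree E r) [IsProbabilityMeasure μ]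
    (hμ : Realizes F E B μ) (hdep : HasMarkovTreeDependence E μ)
    (hB : ∀ i j (h : E i j), (B i j h).IsSI) : PSMD μ := by
  classical
  -- A loop at `i` would lengthen the unique walk from the root to `i`.
  have hne : ∀ {i j}, E i j → i ≠ j := fun {i j} h hij => by
    subst hij
    obtain ⟨l, hl, -⟩ := hT i
    have := (hT i).unique hl (hl.concat h)
    simpa using congrArg List.length this
  set π := Measure.infinitePi fun n => μ.map fun x => x n with hπ
  have hmarg : ∀ n, (μ.map fun x => x n) = π.map fun x => x n := fun n =>
    (map_infinitePi_eval (fun n => μ.map fun x => x n) n).symm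
  have hpair : ∀ {i j}, i ≠ j →
      pairLaw π i j = (μ.map fun x => x i).prod (μ.map fun x => x j) := fun hij =>
    pairLaw_infinitePi _ hij
  have hsi : ∀ i j, E i j → SetwiseIncreasing (pairLaw μ i j) := fun i j h =>
    hμ.setwiseIncreasing h (hB i j h)
  refine processSupermodularLE_of_bounded hT (fun n => (hmarg n).symm)
    fun A hA g c hg hc hsm hgA => ?_
  refine ((hdep.isMarkovAlong hT).integral_le_of_bounded (isMarkovAlong_infinitePi E r _) hmarg hsi
    (fun i j h => ?_) (fun i j h => ?_) hA hg hc hsm hgA).2 fun i j h => ?_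
  · rw [hpair (hne h)]; exact SetwiseIncreasing.prod _ _
  · rw [hpair (hne h).symm]; exact SetwiseIncreasing.prod _ _
  · rw [hpair (hne h)]
    have := (hsi i j h).orthantLE
    rwa [fst_pairLaw, snd_pairLaw] at this

end MarkovTree

theorem corollary1p4 {N : Type*} [Countable N] (E : N → N → Prop) (r : N)
    (hT : IsDirectedTree E r) (F : N → ℝ → I) (B C : ∀ i j, E i j → Copula)
    {Ω Ω' : Type*} [MeasurableSpace Ω] [MeasurableSpace Ω'] (P : Measure Ω) (P' : Measure Ω')
    (X : Ω → N → ℝ) (Y : Ω' → N → ℝ)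
    (hX : FollowsMarkovTree F E B X P) (hY : FollowsMarkovTree F E C Y P')
    (hB : ∀ i j (h : E i j), (B i j h).IsSI)
    (hC : ∀ i j (h : E i j), (C i j h).IsCI) :
    ((∀ i j (h : E i j), (B i j h).LoLE (C i j h)) →
      ProcessSupermodularLE (P.map X) (P'.map Y)) ∧
    ((∀ i j (h : E i j), (C i j h).LoLE (B i j h)) →
      ProcessSupermodularLE (P'.map Y) (P.map X)) ∧
    PSMD (P.map X) ∧ PSMD (P'.map Y) := by
  classical
  obtain ⟨μ, _, hμX, hμ, hμdep⟩ := hX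
  obtain ⟨ν, _, hνY, hν, hνdep⟩ := hY
  rw [hμX.map_eq, hνY.map_eq]
  have hCsi : ∀ i j (h : E i j), (C i j h).IsSI := fun i j h => (hC i j h).isSI
  have hcmp := fun (A) (hA : IsRootedSubtree E r A) (g : (N → ℝ) → ℝ) (c : ℝ) (hg : Measurable g)
      (hc : ∀ x, |g x| ≤ c) (hsm : Supermodular g) (hgA : DependsOn g (↑A : Set N)) =>
    (hμdep.isMarkovAlong hT).integral_le_of_bounded (hνdep.isMarkovAlong hT) (hμ.map_eq hν)
      (fun i j h => hμ.setwiseIncreasing h (hB i j h))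
      (fun i j h => hν.setwiseIncreasing h (hCsi i j h))
      (fun i j h => hν.setwiseIncreasing_swap h (hC i j h)) hA hg hc hsm hgA
  refine ⟨fun hlo => ?_, fun hlo => ?_, psmd_of_realizes hT hμ hμdep hB,
    psmd_of_realizes hT hν hνdep hCsi⟩
  · exact processSupermodularLE_of_bounded hT (hμ.map_eq hν) fun A hA g c hg hc hsm hgA =>
      (hcmp A hA g c hg hc hsm hgA).1 fun i j h => hμ.orthantLE hν h (hlo i j h)
  · exact processSupermodularLE_of_bounded hT (hν.map_eq hμ) fun A hA g c hg hc hsm hgA =>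
      (hcmp A hA g c hg hc hsm hgA).2 fun i j h => hν.orthantLE hμ h (hlo i j h)
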